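/- Let $Q$ be a finite quiver with vertex set $Q_0$; an arrow $a$ has tail $t(a)$ and head $h(a)$, paths are composed from right to left, and $e_v$ is the trivial path at $v$. Call $Q$ biserial if every vertex is the head of at most two arrows and the tail of at most two arrows. Let $Z$ be a set of paths of length at least $2$ such that $(Q,Z)$ is special: for every arrow $b$ there is at most one arrow $a$ with $t(a)=h(b)$ and $ab\notin Z$, and at most one arrow $c$ with $h(c)=t(b)$ and $bc\notin Z$. A path is $Z$-admissible if it is not of the form $pzq$ with paths $p,q$ and $z\in Z$. A $Z$-primitive cycle is a path $c$ of positive length with $h(c)=t(c)$ such that $c^m$ is $Z$-admissible for all $m\ge 1$ and $c\neq d^k$ for every $k>1$ and every $Z$-admissible cycle $d$ shorter than $c$. Let $V(c)$ be the set of vertices traversed by $c$, let $V=\bigcup_c V(c)$ with $c$ running through the $Z$-primitive cycles, and let $V=V[1]\sqcup\dots\sqcup V[n]$ be the primitive-nerve partition, that is, the partition of $V$ into the classes of the transitive closure of the reflexive and symmetric relation $\bigcup_c V(c)\times V(c)$ on $V$. Let $(R,\mathfrak m)$ be a (commutative, noetherian) regular local ring of dimension $n$, and let $(s_1,\dots,s_n)$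 be a regular sequence that generates $\mathfrak m$. There are only finitely many $Z$-primitive cycles at each vertex $v$; let $\sigma_v\in RQ$ be their sum. Define the two-sided ideal $$I=\langle Z\rangle+\sum_{i=1}^n\Big(\langle s_ie_v-\sigma_v : v\in V[i]\rangle+\langle s_ie_v : v\in Q_0\setminus V[i]\rangle\Big)$$ of the path algebra $RQ$. Then every $Z$-admissible path lies outside $I$. Moreover, if $Q$ is biserial, then $\Lambda=RQ/I$ is a string algebra over $R$. This means the following, where $A_\ell\subseteq RQ$ is the $R$-span of the paths of length $\ell$, $A=\bigoplus_{\ell\ge1}A_\ell$, and $\mathfrak mQ$ is the set of $R$-linear combinations of paths with coefficients in $\mathfrak m$. (i) $I$ is admissible: $I\subseteq A+\mathfrak mQ$, $I\cap A\subseteq A^2+(\mathfrak mQ\cap A)$, and there are integers $m,h>0$ with $A^m\subseteq I+\mathfrak mQ$ and $\mathfrak mQ\subseteq I+\sum_{\ell=1}^hA_\ell$. (ii) $I$ is special: for every arrow $b$ there is at most one arrow $a$ with $t(a)=h(b)$ and $ab\notin I$, and at most one arrow $c$ with $h(c)=t(b)$ and $bc\notin I$. (iii) $I$ is arrow-direct: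 for every arrow $a$, one has $\Lambda a\cap\sum_b\Lambda b=0$, where $b$ runs over the arrows $b\ne a$ with $t(b)=t(a)$, and $a\Lambda\cap\sum_b b\Lambda=0$, where $b$ runs over the arrows $b\neq a$ with $h(b)=h(a)$. -/

import Mathlib

universe u v w

/-! ### Paths in a quiver

A quiver is given by Mathlib's `Quiver V`: the vertices are the elements of `V`, and an arrow `a`
with tail `t(a) = x` and head `h(a) = y` is an element of `x ⟶ y`. Note that Mathlib composes
paths in diagrammatic order, so that the path written `p q` (first `q`, then `p`) in the
right-to-left convention is `q.comp p`. -/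

/-- A path of arbitrary tail and head. -/
structure QPath (V : Type u) [Quiver.{v} V] where
  tail : V
  head : V
  path : Quiver.Path tail head

namespace QPath

variable {V : Type u} [Quiver.{v} V]

/-- The length of a path. -/
def length (p : QPath V) : ℕ := p.path.length

/-- The trivial path `e_x`. -/
def triv (x : V) : QPath V := ⟨x, x, Quiver.Path.nil⟩

/-- An arrow as a path of length one. -/
def ofArrow {x y : V} (a : x ⟶ y) : QPath V := ⟨x, y, a.toPath⟩

/-- The path of length two written `a b` from right to left: first `b`, then `a`. -/
def ofArrows {x y z : V} (a : y ⟶ z) (b : x ⟶ y) : QPath V := ⟨x, z, b.toPath.comp a.toPath⟩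

/-- The composition `p q` (first `q`, then `p`) of two composable paths. -/
def comp (p q : QPath V) (h : q.head = p.tail) : QPath V :=
  ⟨q.tail, p.head, (q.path.cast rfl h).comp p.path⟩

theorem comp_triv (p : QPath V) (x : V) (h : x = p.tail) : p.comp (triv x) h = p := by
  obtain ⟨a, b, p⟩ := p
  dsimp only at h
  subst h
  simp [comp, triv]

theorem triv_comp (p : QPath V) (x : V) (h : p.head = x) : (triv x).comp p h = p := by
  obtain ⟨a, b, p⟩ := p
  dsimp only at h
  subst h
  simp [comp, triv]

theorem comp_assoc (p q r : QPath V) (h : q.head = p.tail) (h' : r.head = q.tail) :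
    (p.comp q h).comp r h' = p.comp (q.comp r h') h := by
  obtain ⟨a, b, p⟩ := p
  obtain ⟨c, d, q⟩ := q
  obtain ⟨e, f, r⟩ := r
  dsimp only at h h'
  subst h h'
  simp [comp]

end QPath

/-! ### The path algebra -/

/-- The path algebra `RQ`: the free `R`-module on the paths, with multiplication induced by the
composition of paths (the product of two paths that do not compose being zero). -/
def PathAlgebra (R : Type w) [CommRing R] (V : Type u) [Quiver.{v} V] : Type (max u v w) :=
  QPath V →₀ R

namespace PathAlgebra

variable (R : Type w) [CommRing R] {V : Type u} [Quiver.{v} V]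

noncomputable instance : AddCommGroup (PathAlgebra R V) :=
  inferInstanceAs (AddCommGroup (QPath V →₀ R))

noncomputable instance : Module R (PathAlgebra R V) :=
  inferInstanceAs (Module R (QPath V →₀ R))

/-- The basis of `RQ` given by the paths. -/
noncomputable def basis : Module.Basis (QPath V) R (PathAlgebra R V) :=
  ⟨LinearEquiv.refl R (QPath V →₀ R)⟩

/-- A path, as an element of `RQ`. -/
noncomputable def ofPath (p : QPath V) : PathAlgebra R V := basis R p

open Classical in
/-- The product of two paths in `RQ`. -/
noncomputable def pathMul (p q : QPath V) : PathAlgebra R V :=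
  if h : q.head = p.tail then ofPath R (p.comp q h) else 0

/-- The multiplication of `RQ`, as a bilinear map. -/
noncomputable def mulLin : PathAlgebra R V →ₗ[R] PathAlgebra R V →ₗ[R] PathAlgebra R V :=
  (basis R).constr R fun p => (basis R).constr R fun q => pathMul R p q

theorem mulLin_ofPath (p q : QPath V) :
    mulLin R (ofPath R p) (ofPath R q) = pathMul R p q := by
  simp [mulLin, ofPath]

variable {R} in
theorem induction_linear {P : PathAlgebra R V → Prop} (x : PathAlgebra R V)
    (zero : P 0) (add : ∀ x y, P x → P y → P (x + y))
    (smul : ∀ (r : R) (p : QPath V), P (r • ofPath R p)) : P x := by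
  refine Finsupp.induction_linear (motive := P) x zero (fun f g hf hg => add f g hf hg) ?_
  intro p r
  have h := smul r p
  have e : r • ofPath R p = (Finsupp.single p r : QPath V →₀ R) := by
    change r • (Finsupp.single p (1 : R) : QPath V →₀ R) = _
    rw [Finsupp.smul_single, smul_eq_mul, mul_one]
  rw [e] at h
  exact h

theorem mulLin_assoc (x y z : PathAlgebra R V) :
    mulLin R (mulLin R x y) z = mulLin R x (mulLin R y z) := by
  have hz : ∀ p q r : QPath V, mulLin R (mulLin R (ofPath R p) (ofPath R q)) (ofPath R r)
      = mulLin R (ofPath R p) (mulLin R (ofPath R q) (ofPath R r)) := by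
    intro p q r
    rw [mulLin_ofPath, mulLin_ofPath]
    by_cases h : q.head = p.tail <;> by_cases h' : r.head = q.tail
    · have h1 : r.head = (p.comp q h).tail := h'
      have h2 : (q.comp r h').head = p.tail := h
      simp only [pathMul, h, h', dif_pos]
      rw [mulLin_ofPath, mulLin_ofPath]
      simp only [pathMul, h1, h2, dif_pos]
      exact congrArg _ (QPath.comp_assoc p q r h h')
    · have h1 : ¬ r.head = (p.comp q h).tail := h'
      simp only [pathMul, h, h', dif_pos, dif_neg, not_false_eq_true, map_zero]
      rw [mulLin_ofPath]
      simp only [pathMul, h1, dif_neg, not_false_eq_true]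
    · have h2 : ¬ (q.comp r h').head = p.tail := h
      simp only [pathMul, h, h', dif_pos, dif_neg, not_false_eq_true, map_zero,
        LinearMap.zero_apply]
      rw [mulLin_ofPath]
      simp only [pathMul, h2, dif_neg, not_false_eq_true]
    · simp [pathMul, h, h']
  induction x using induction_linear with
  | zero => simp
  | add x x' hx hx' => simp only [map_add, LinearMap.add_apply, hx, hx']
  | smul a p =>
    induction y using induction_linear with
    | zero => simp
    | add y y' hy hy' => simp only [map_add, LinearMap.add_apply, hy, hy']
    | smul b q =>
      induction z using induction_linear with
      | zero => simp
      | add z z' hz hz' => simp only [map_add, hz, hz']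
      | smul c r => simp only [map_smul, LinearMap.smul_apply, hz p q r]

/-- The element `e_x` of `RQ`. -/
noncomputable def e (x : V) : PathAlgebra R V := ofPath R (QPath.triv x)

/-- An arrow, as an element of `RQ`. -/
noncomputable def arrow {x y : V} (a : x ⟶ y) : PathAlgebra R V := ofPath R (QPath.ofArrow a)

theorem one_mulLin [Fintype V] (x : PathAlgebra R V) : mulLin R (∑ v : V, e R v) x = x := by
  classical
  induction x using induction_linear with
  | zero => simp
  | add x x' hx hx' => simp only [map_add, hx, hx']
  | smul a p =>
    rw [map_smul, map_sum, LinearMap.sum_apply]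
    congr 1
    rw [Finset.sum_eq_single p.head]
    · rw [e, mulLin_ofPath, pathMul, dif_pos (show p.head = (QPath.triv p.head).tail from rfl)]
      exact congrArg _ (QPath.triv_comp p p.head rfl)
    · intro b _ hb
      rw [e, mulLin_ofPath, pathMul, dif_neg]
      exact fun h => hb h.symm
    · simp

theorem mulLin_one [Fintype V] (x : PathAlgebra R V) : mulLin R x (∑ v : V, e R v) = x := by
  classical
  induction x using induction_linear with
  | zero => simp
  | add x x' hx hx' => simp only [map_add, LinearMap.add_apply, hx, hx']
  | smul a p =>
    rw [map_smul, map_sum]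
    rw [Finset.sum_eq_single p.tail]
    · rw [e, LinearMap.smul_apply, mulLin_ofPath, pathMul,
        dif_pos (show (QPath.triv p.tail).head = p.tail from rfl)]
      exact congrArg _ (congrArg _ (QPath.comp_triv p p.tail rfl))
    · intro b _ hb
      rw [e, LinearMap.smul_apply, mulLin_ofPath, pathMul, dif_neg, smul_zero]
      exact hb
    · simp

noncomputable instance [Fintype V] : Ring (PathAlgebra R V) where
  __ := (inferInstance : AddCommGroup (PathAlgebra R V))
  mul x y := mulLin R x y
  one := ∑ v : V, e R v
  left_distrib x y z := map_add (mulLin R x) y z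
  right_distrib x y z := by
    change mulLin R (x + y) z = mulLin R x z + mulLin R y z
    rw [map_add, LinearMap.add_apply]
  zero_mul x := by
    change mulLin R 0 x = 0
    rw [map_zero, LinearMap.zero_apply]
  mul_zero x := map_zero (mulLin R x)
  mul_assoc x y z := mulLin_assoc R x y z
  one_mul x := one_mulLin R x
  mul_one x := mulLin_one R x

noncomputable instance [Fintype V] : Algebra R (PathAlgebra R V) :=
  Algebra.ofModule
    (fun r x y => by
      change mulLin R (r • x) y = r • mulLin R x y
      rw [map_smul, LinearMap.smul_apply])
    (fun r x y => map_smul (mulLin R x) r y)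

end PathAlgebra

/-! ### Zero-relations, primitive cycles and the primitive-nerve partition -/

section Combinatorics

variable {V : Type u} [Quiver.{v} V]

/-- Every vertex is the head of at most two arrows and the tail of at most two arrows. -/
def IsBiserial (V : Type u) [Quiver.{v} V] : Prop :=
  ∀ x : V, ENat.card (Σ y : V, y ⟶ x) ≤ 2 ∧ ENat.card (Σ y : V, x ⟶ y) ≤ 2

/-- The pair `(Q, Z)` is special. -/
def IsSpecialPair (Z : Set (QPath V)) : Prop :=
  (∀ (x y : V) (b : x ⟶ y),
    {a : Σ z : V, y ⟶ z | QPath.ofArrows a.2 b ∉ Z}.Subsingleton) ∧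
  (∀ (x y : V) (b : x ⟶ y),
    {c : Σ z : V, z ⟶ x | QPath.ofArrows b c.2 ∉ Z}.Subsingleton)

/-- A path is `Z`-admissible if no element of `Z` is a subpath of it. -/
def IsZAdmissible (Z : Set (QPath V)) {x y : V} (p : Quiver.Path x y) : Prop :=
  ¬ ∃ z ∈ Z, ∃ (q : Quiver.Path x z.tail) (r : Quiver.Path z.head y),
    p = (q.comp z.path).comp r

/-- The powers of a path with equal head and tail. -/
def cyclePow {x : V} (c : Quiver.Path x x) : ℕ → Quiver.Path x x
  | 0 => Quiver.Path.nil
  | n + 1 => (cyclePow c n).comp c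

/-- `Z`-primitive cycles at the vertex `x`. -/
structure IsPrimitiveCycle (Z : Set (QPath V)) {x : V} (c : Quiver.Path x x) : Prop where
  nontrivial : 0 < c.length
  admissible : ∀ n : ℕ, 0 < n → IsZAdmissible Z (cyclePow c n)
  not_power : ¬ ∃ d : Quiver.Path x x, 0 < d.length ∧ d.length < c.length ∧ IsZAdmissible Z d ∧
    ∃ k : ℕ, 1 < k ∧ c = cyclePow d k

/-- The relation `⋃_c V(c) × V(c)`, where `c` runs through the `Z`-primitive cycles and `V(c)` is
the set of vertices traversed by `c`. -/
def PrimRel (Z : Set (QPath V)) (x y : V) : Prop :=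
  ∃ (z : V) (c : Quiver.Path z z), IsPrimitiveCycle Z c ∧ x ∈ c.vertices ∧ y ∈ c.vertices

/-- A primitive vertex is one that is traversed by some `Z`-primitive cycle. -/
def IsPrimitiveVertex (Z : Set (QPath V)) (x : V) : Prop :=
  ∃ (z : V) (c : Quiver.Path z z), IsPrimitiveCycle Z c ∧ x ∈ c.vertices

/-- The parts of the primitive-nerve partition: the classes of primitive vertices under the
transitive closure of `PrimRel Z` (which is reflexive on primitive vertices, and symmetric). -/
def nerveParts (Z : Set (QPath V)) : Set (Set V) :=
  {S | ∃ x, IsPrimitiveVertex Z x ∧ S = {y | Relation.TransGen (PrimRel Z) x y}}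

/-- `P 0, …, P (n - 1)` are the parts, each listed exactly once, of the primitive-nerve
partition. -/
structure IsPrimitiveNervePartition (Z : Set (QPath V)) {n : ℕ} (P : Fin n → Set V) : Prop where
  injective : Function.Injective P
  range_eq : Set.range P = nerveParts Z

end Combinatorics

/-! ### Ideals of the path algebra -/

section Ideals

variable (R : Type w) [CommRing R] {V : Type u} [Quiver.{v} V]

/-- `σ_x`, the sum of the `Z`-primitive cycles at `x` (finitely many, if `Q` is finite and
`(Q, Z)` is special). -/
noncomputable def sigma (Z : Set (QPath V)) (x : V) : PathAlgebra R V :=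
  ∑ᶠ c ∈ {c : Quiver.Path x x | IsPrimitiveCycle Z c}, PathAlgebra.ofPath R ⟨x, x, c⟩

/-- The `R`-span `A_ℓ` of the paths of length `ℓ`. -/
noncomputable def lengthSpan (V : Type u) [Quiver.{v} V] (l : ℕ) : Submodule R (PathAlgebra R V) :=
  Submodule.span R {x | ∃ p : QPath V, p.length = l ∧ x = PathAlgebra.ofPath R p}

/-- `A`, the sum of the `A_ℓ` with `ℓ ≥ 1`. -/
noncomputable def arrowIdeal (V : Type u) [Quiver.{v} V] : Submodule R (PathAlgebra R V) :=
  ⨆ l ∈ Set.Ici 1, lengthSpan R V l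

variable {R}

/-- `𝔞Q`, the linear combinations of paths with coefficients in `𝔞`. -/
noncomputable def coeffIdeal (𝔞 : Ideal R) (V : Type u) [Quiver.{v} V] : Submodule R (PathAlgebra R V) where
  carrier := {x | ∀ p : QPath V, (PathAlgebra.basis R).repr x p ∈ 𝔞}
  add_mem' hx hy p := by
    rw [map_add, Finsupp.add_apply]
    exact 𝔞.add_mem (hx p) (hy p)
  zero_mem' p := by
    rw [map_zero, Finsupp.zero_apply]
    exact 𝔞.zero_mem
  smul_mem' r x hx p := by
    rw [map_smul, Finsupp.smul_apply]
    exact 𝔞.mul_mem_left r (hx p)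

variable [Fintype V]

/-- The `R`-submodule of `RQ` underlying a two-sided ideal. -/
noncomputable def idealSubmodule (I : TwoSidedIdeal (PathAlgebra R V)) : Submodule R (PathAlgebra R V) :=
  (TwoSidedIdeal.asIdeal I).restrictScalars R

/-- Admissible ideals of `RQ`, for a local ring `R`. -/
structure IsAdmissibleIdeal [IsLocalRing R] (I : TwoSidedIdeal (PathAlgebra R V)) : Prop where
  le_add : idealSubmodule I ≤ arrowIdeal R V ⊔ coeffIdeal (IsLocalRing.maximalIdeal R) V
  inf_le : idealSubmodule I ⊓ arrowIdeal R V ≤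
    arrowIdeal R V ^ 2 ⊔ coeffIdeal (IsLocalRing.maximalIdeal R) V ⊓ arrowIdeal R V
  pow_le : ∃ m : ℕ, 0 < m ∧
    arrowIdeal R V ^ m ≤ idealSubmodule I ⊔ coeffIdeal (IsLocalRing.maximalIdeal R) V
  coeff_le : ∃ h : ℕ, 0 < h ∧
    coeffIdeal (IsLocalRing.maximalIdeal R) V ≤
      idealSubmodule I ⊔ ⨆ l ∈ Set.Icc 1 h, lengthSpan R V l

/-- Special ideals of `RQ`. -/
def IsSpecialIdeal (I : TwoSidedIdeal (PathAlgebra R V)) : Prop :=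
  (∀ (x y : V) (b : x ⟶ y),
    {a : Σ z : V, y ⟶ z | PathAlgebra.arrow R a.2 * PathAlgebra.arrow R b ∉ I}.Subsingleton) ∧
  (∀ (x y : V) (b : x ⟶ y),
    {c : Σ z : V, z ⟶ x | PathAlgebra.arrow R b * PathAlgebra.arrow R c.2 ∉ I}.Subsingleton)

/-- The image of an arrow in the quotient algebra `Λ = RQ / I`. -/
noncomputable def quotArrow (I : TwoSidedIdeal (PathAlgebra R V)) {x y : V} (a : x ⟶ y) : I.ringCon.Quotient :=
  I.ringCon.mk' (PathAlgebra.arrow R a)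

/-- Arrow-direct ideals of `RQ`: in `Λ = RQ / I`, for any arrow `a` one has `Λ a ∩ ∑ Λ b = 0`,
where `b ≠ a` runs through the other arrows with the same tail, and `a Λ ∩ ∑ b Λ = 0`, where
`b ≠ a` runs through the other arrows with the same head. Right ideals are submodules over the
opposite ring. -/
def IsArrowDirect (I : TwoSidedIdeal (PathAlgebra R V)) : Prop :=
  ∀ (x y : V) (a : x ⟶ y),
    (Submodule.span I.ringCon.Quotient {quotArrow I a} ⊓
      (⨆ b ∈ {b : Σ z : V, x ⟶ z | b ≠ ⟨y, a⟩},
        Submodule.span I.ringCon.Quotient {quotArrow I b.2}) = ⊥) ∧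
    (Submodule.span I.ringCon.Quotientᵐᵒᵖ {quotArrow I a} ⊓
      (⨆ b ∈ {b : Σ z : V, z ⟶ y | b ≠ ⟨x, a⟩},
        Submodule.span I.ringCon.Quotientᵐᵒᵖ {quotArrow I b.2}) = ⊥)

/-- The quotient `RQ / I` is (presented by `Q` and `I` as) a string algebra over `R`. -/
structure IsStringAlgebra [IsLocalRing R] (I : TwoSidedIdeal (PathAlgebra R V)) : Prop where
  biserial : IsBiserial V
  admissible : IsAdmissibleIdeal I
  special : IsSpecialIdeal I
  arrowDirect : IsArrowDirect I

/-- The ideal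
`I = ⟨Z⟩ + ∑_i (⟨s_i e_x - σ_x : x ∈ P i⟩ + ⟨s_i e_x : x ∉ P i⟩)`. -/
noncomputable def stringIdeal (Z : Set (QPath V)) {n : ℕ} (P : Fin n → Set V) (s : Fin n → R) :
    TwoSidedIdeal (PathAlgebra R V) :=
  TwoSidedIdeal.span (PathAlgebra.ofPath R '' Z) ⊔
    ⨆ i : Fin n,
      (TwoSidedIdeal.span {y | ∃ x ∈ P i, y = s i • PathAlgebra.e R x - sigma R Z x} ⊔
        TwoSidedIdeal.span {y | ∃ x ∉ P i, y = s i • PathAlgebra.e R x})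

end Ideals

/-!
Since `(Q, Z)` is special, each arrow is followed by at most one arrow, so a nontrivial admissible
path is determined by its first arrow and its length, and the primitive cycles come from periodic
orbits of the successor map on arrows. Modulo inadmissible paths, the relators `s_i e_v - σ_v` and
`s_i e_v` commute with all paths. Hence the ideal `I` is spanned by the inadmissible paths and the
products `q ρ` of a path `q` with a relator `ρ`. As `s` is a regular sequence, `I ∩ A` is spanned
by the inadmissible paths and those products with `q` nontrivial.

For a primitive cycle `c` at a vertex of `V[i]`, consider the functional that sends an admissible
path starting with the first arrow of `c` to `s_i ^ k`, where `k` is the number of times it winds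
around `c`, and all other paths to `0`. It maps `I ∩ A` into the ideal generated by the `s_j` with
`j ≠ i`, which contains no power of `s_i`; so no admissible path starting with `c` lies in `I`. An
admissible path that starts with no primitive cycle only has coefficients from `𝔪` in elements of
`I`. Finally, the spanning set of `I ∩ A` is compatible with sorting nontrivial paths by their first
or by their last arrow, whence arrow-directness.
-/

/-! ### Paths as words of arrows -/

section Words

open Quiver Quiver.Path

variable {V : Type u} [Quiver.{v} V]

instance [Finite V] [∀ x y : V, Finite (x ⟶ y)] : Finite (Total V) :=
  Finite.of_surjective (fun a : Σ x : V, Σ y : V, (x ⟶ y) => (⟨a.1, a.2.1, a.2.2⟩ : Total V))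
    fun a => ⟨⟨a.left, a.right, a.hom⟩, rfl⟩

/-- The word of arrows traversed by a path, from its tail to its head. -/
def arrowList {x : V} : ∀ {y : V}, Path x y → List (Total V)
  | _, .nil => []
  | _, .cons p a => arrowList p ++ [⟨_, _, a⟩]

@[simp] theorem arrowList_nil (x : V) : arrowList (nil : Path x x) = [] := rfl

@[simp] theorem arrowList_cons {x y z : V} (p : Path x y) (a : y ⟶ z) :
    arrowList (p.cons a) = arrowList p ++ [⟨y, z, a⟩] := rfl

@[simp] theorem arrowList_toPath {x y : V} (a : x ⟶ y) : arrowList a.toPath = [⟨x, y, a⟩] := rfl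

@[simp] theorem arrowList_comp {x y z : V} (p : Path x y) (q : Path y z) :
    arrowList (p.comp q) = arrowList p ++ arrowList q := by
  induction q with
  | nil => simp
  | cons q a ih => simp [ih]

@[simp] theorem length_arrowList {x y : V} (p : Path x y) : (arrowList p).length = p.length := by
  induction p with
  | nil => rfl
  | cons p a ih => simp [ih]

theorem arrowList_ne_nil {x y : V} {p : Path x y} (h : 0 < p.length) : arrowList p ≠ [] := by
  rwa [← List.length_pos_iff, length_arrowList]

theorem mk_eq_of_arrowList_eq {x y z : V} {p : Path x y} {q : Path x z}
    (h : arrowList p = arrowList q) : (⟨x, y, p⟩ : QPath V) = ⟨x, z, q⟩ := by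
  induction p generalizing z with
  | nil =>
    cases q with
    | nil => rfl
    | cons q b => simp at h
  | cons p a ih =>
    cases q with
    | nil => simp at h
    | cons q b =>
      obtain ⟨hpq, hab⟩ := List.append_inj' h rfl
      cases ih hpq
      cases hab
      rfl

theorem arrowList_injective {x y : V} : Function.Injective (arrowList (x := x) (y := y)) :=
  fun _ _ h => by cases mk_eq_of_arrowList_eq h; rfl

theorem exists_head?_arrowList {x y : V} {p : Path x y} (h : 0 < p.length) :
    ∃ b, (arrowList p).head? = some b :=
  ⟨_, List.head?_eq_some_head (arrowList_ne_nil h)⟩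

theorem exists_toPath_comp_of_head?_arrowList {x z : V} {p : Path x z} {b : Total V}
    (h : (arrowList p).head? = some b) :
    ∃ (y : V) (a : x ⟶ y) (q : Path y z), b = ⟨x, y, a⟩ ∧ p = a.toPath.comp q := by
  have hp : p.length ≠ 0 := fun h0 => by
    rw [← length_arrowList, List.length_eq_zero_iff] at h0
    simp [h0] at h
  obtain ⟨m, hm⟩ := Nat.exists_eq_succ_of_ne_zero hp
  obtain ⟨y, a, q, -, rfl⟩ := p.eq_toPath_comp_of_length_eq_succ hm
  simp only [arrowList_comp, arrowList_toPath, List.singleton_append, List.head?_cons,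
    Option.some.injEq] at h
  exact ⟨y, a, q, h.symm, rfl⟩

theorem left_of_head?_arrowList {x y : V} {p : Path x y} {b : Total V}
    (h : (arrowList p).head? = some b) : b.left = x := by
  obtain ⟨_, _, _, rfl, -⟩ := exists_toPath_comp_of_head?_arrowList h
  rfl

theorem left_eq_of_head?_arrowList_eq {w x y z : V} {p : Path w x} {q : Path y z}
    (hp : 0 < p.length) (h : (arrowList p).head? = (arrowList q).head?) : w = y := by
  obtain ⟨b, hb⟩ := exists_head?_arrowList hp
  exact (left_of_head?_arrowList hb).symm.trans (left_of_head?_arrowList (h ▸ hb))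

theorem head?_arrowList_comp {x y z : V} {p : Path x y} (q : Path y z) (h : 0 < p.length) :
    (arrowList (p.comp q)).head? = (arrowList p).head? := by
  rw [arrowList_comp, List.head?_append_of_ne_nil _ (arrowList_ne_nil h)]

theorem getLast?_arrowList_comp {x y z : V} (p : Path x y) {q : Path y z} (h : 0 < q.length) :
    (arrowList (p.comp q)).getLast? = (arrowList q).getLast? := by
  rw [arrowList_comp, List.getLast?_append_of_ne_nil _ (arrowList_ne_nil h)]

theorem cyclePow_one {x : V} (c : Path x x) : cyclePow c 1 = c := by
  simp [cyclePow]

theorem cyclePow_succ' {x : V} (c : Path x x) (m : ℕ) :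
    cyclePow c (m + 1) = c.comp (cyclePow c m) := by
  induction m with
  | zero => simp [cyclePow]
  | succ m ih =>
    rw [cyclePow, ih, comp_assoc, ← ih]
    rfl

theorem length_cyclePow {x : V} (c : Path x x) (m : ℕ) :
    (cyclePow c m).length = m * c.length := by
  induction m with
  | zero => simp [cyclePow]
  | succ m ih => rw [cyclePow, length_comp, ih, Nat.succ_mul]

theorem cyclePow_comp {x y : V} (p : Path x y) (q : Path y x) (m : ℕ) :
    cyclePow (p.comp q) (m + 1) = (p.comp (cyclePow (q.comp p) m)).comp q := by
  induction m with
  | zero => simp [cyclePow]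
  | succ m ih =>
    rw [cyclePow, ih, cyclePow]
    simp only [comp_assoc]

theorem arrowList_cyclePow {x : V} {c : Path x x} {f : Total V → Total V} {b : Total V}
    (hc : arrowList c = List.iterate f b c.length) (hb : Function.IsPeriodicPt f c.length b)
    (m : ℕ) : arrowList (cyclePow c m) = List.iterate f b (m * c.length) := by
  induction m with
  | zero => simp [cyclePow]
  | succ m ih =>
    rw [cyclePow, arrowList_comp, ih, Nat.succ_mul, List.iterate_add,
      show f^[m * c.length] b = b from hb.const_mul m, ← hc]

end Words

/-! ### Admissible paths -/

section Admissible

open Quiver Quiver.Path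

variable {V : Type u} [Quiver.{v} V] {Z : Set (QPath V)}

theorem not_isZAdmissible_of_mem {z : QPath V} (hz : z ∈ Z) : ¬ IsZAdmissible Z z.path :=
  fun h => h ⟨z, hz, nil, nil, by simp⟩

theorem IsZAdmissible.of_comp_left {x y z : V} {p : Path x y} {q : Path y z}
    (h : IsZAdmissible Z (p.comp q)) : IsZAdmissible Z p := by
  rintro ⟨r, hr, a, b, rfl⟩
  exact h ⟨r, hr, a, b.comp q, by simp only [comp_assoc]⟩

theorem IsZAdmissible.of_comp_right {x y z : V} {p : Path x y} {q : Path y z}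
    (h : IsZAdmissible Z (p.comp q)) : IsZAdmissible Z q := by
  rintro ⟨r, hr, a, b, rfl⟩
  exact h ⟨r, hr, p.comp a, b, by simp only [comp_assoc]⟩

theorem two_le_length_of_not_isZAdmissible (hZ : ∀ z ∈ Z, 2 ≤ z.length) {x y : V} {p : Path x y}
    (h : ¬ IsZAdmissible Z p) : 2 ≤ p.length := by
  obtain ⟨z, hz, a, b, rfl⟩ := not_not.mp h
  have : 2 ≤ z.path.length := hZ z hz
  simp only [length_comp]
  omega

/-- The arrow `a` can follow the arrow `b`: they compose and `a b ∉ Z`. -/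
inductive Follows (Z : Set (QPath V)) : Total V → Total V → Prop
  | intro {x y z : V} (b : x ⟶ y) (a : y ⟶ z) (h : QPath.ofArrows a b ∉ Z) :
      Follows Z ⟨x, y, b⟩ ⟨y, z, a⟩

theorem Follows.right_unique (hsp : IsSpecialPair Z) {b a a' : Total V}
    (h : Follows Z b a) (h' : Follows Z b a') : a = a' := by
  obtain ⟨b, a, h⟩ := h
  obtain ⟨_, a', h'⟩ := h'
  cases hsp.1 _ _ b (show ⟨_, a⟩ ∈ _ from h) (show ⟨_, a'⟩ ∈ _ from h')
  rfl

theorem Follows.left_unique (hsp : IsSpecialPair Z) {b b' a : Total V}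
    (h : Follows Z b a) (h' : Follows Z b' a) : b = b' := by
  obtain ⟨b, a, h⟩ := h
  obtain ⟨b', _, h'⟩ := h'
  cases hsp.2 _ _ a (show ⟨_, b⟩ ∈ _ from h) (show ⟨_, b'⟩ ∈ _ from h')
  rfl

theorem IsZAdmissible.isChain {x y : V} {p : Path x y} (h : IsZAdmissible Z p) :
    (arrowList p).IsChain (Follows Z) := by
  induction p with
  | nil => simp
  | cons p a ih =>
    rw [arrowList_cons, List.isChain_append]
    refine ⟨ih (IsZAdmissible.of_comp_left (q := a.toPath) h), by simp, ?_⟩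
    cases p with
    | nil => simp
    | cons p b =>
      simp only [arrowList_cons, List.getLast?_append, List.getLast?_singleton, Option.some_or,
        Option.mem_def, Option.some.injEq, List.head?_cons]
      rintro _ rfl _ rfl
      exact .intro b a fun hz => h ⟨_, hz, p, nil, rfl⟩

theorem IsZAdmissible.follows_getLast?_head? {x y z : V} {p : Path x y} {q : Path y z}
    (h : IsZAdmissible Z (p.comp q)) {a b : Total V} (ha : (arrowList p).getLast? = some a)
    (hb : (arrowList q).head? = some b) : Follows Z a b := by
  have hchain := h.isChain
  rw [arrowList_comp, List.isChain_append] at hchain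
  exact hchain.2.2 _ ha _ hb

open Classical in
/-- The arrow that follows a given arrow. For a special pair it is unique if it exists; if no arrow
follows `b`, then `nextArrow Z b` is `b` itself. -/
noncomputable def nextArrow (Z : Set (QPath V)) (b : Total V) : Total V :=
  if h : ∃ a, Follows Z b a then h.choose else b

theorem Follows.nextArrow_eq (hsp : IsSpecialPair Z) {b a : Total V} (h : Follows Z b a) :
    nextArrow Z b = a := by
  have hex : ∃ a, Follows Z b a := ⟨a, h⟩
  rw [nextArrow, dif_pos hex]
  exact hex.choose_spec.right_unique hsp h

theorem eq_iterate_nextArrow_of_isChain (hsp : IsSpecialPair Z) {l : List (Total V)}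
    (hl : l.IsChain (Follows Z)) {b : Total V} (hb : l.head? = some b) :
    l = List.iterate (nextArrow Z) b l.length := by
  induction l generalizing b with
  | nil => simp at hb
  | cons a l ih =>
    obtain rfl : a = b := Option.some.inj hb
    rw [List.length_cons, List.iterate]
    congr 1
    cases l with
    | nil => rfl
    | cons a' l =>
      rw [List.isChain_cons_cons] at hl
      rw [hl.1.nextArrow_eq hsp]
      exact ih hl.2 rfl

theorem IsZAdmissible.arrowList_eq_iterate (hsp : IsSpecialPair Z) {x y : V} {p : Path x y}
    (h : IsZAdmissible Z p) {b : Total V} (hb : (arrowList p).head? = some b) :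
    arrowList p = List.iterate (nextArrow Z) b p.length := by
  rw [← length_arrowList]
  exact eq_iterate_nextArrow_of_isChain hsp h.isChain hb

theorem IsZAdmissible.mk_eq (hsp : IsSpecialPair Z) {x y z : V} {p : Path x y} {q : Path x z}
    (hp : IsZAdmissible Z p) (hq : IsZAdmissible Z q)
    (h : (arrowList p).head? = (arrowList q).head?) (hl : p.length = q.length) :
    (⟨x, y, p⟩ : QPath V) = ⟨x, z, q⟩ := by
  apply mk_eq_of_arrowList_eq
  rcases Nat.eq_zero_or_pos p.length with h0 | h0
  · rw [List.length_eq_zero_iff.mp ((length_arrowList p).trans h0),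
      List.length_eq_zero_iff.mp ((length_arrowList q).trans (hl ▸ h0))]
  · obtain ⟨b, hb⟩ := exists_head?_arrowList h0
    rw [hp.arrowList_eq_iterate hsp hb, hq.arrowList_eq_iterate hsp (h ▸ hb), hl]

theorem IsZAdmissible.eq (hsp : IsSpecialPair Z) {x y : V} {p q : Path x y}
    (hp : IsZAdmissible Z p) (hq : IsZAdmissible Z q)
    (h : (arrowList p).head? = (arrowList q).head?) (hl : p.length = q.length) : p = q := by
  cases hp.mk_eq hsp hq h hl
  rfl

theorem IsZAdmissible.exists_eq_comp (hsp : IsSpecialPair Z) {x y z : V} {p : Path x y}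
    {q : Path x z} (hp : IsZAdmissible Z p) (hq : IsZAdmissible Z q) (h0 : 0 < p.length)
    (h : (arrowList p).head? = (arrowList q).head?) (hl : p.length ≤ q.length) :
    ∃ r : Path y z, q = p.comp r := by
  obtain ⟨w, d, r, rfl, hd⟩ := q.exists_eq_comp_of_le_length hl
  rw [head?_arrowList_comp r (hd ▸ h0)] at h
  cases hp.mk_eq hsp hq.of_comp_left h hd.symm
  exact ⟨r, rfl⟩

theorem IsZAdmissible.head?_right (hsp : IsSpecialPair Z) {x y z : V} {p : Path x y}
    {q : Path y z} (h : IsZAdmissible Z (p.comp q)) (hp : 0 < p.length) (hq : 0 < q.length)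
    {b : Total V} (hb : (arrowList p).head? = some b) :
    (arrowList q).head? = some ((nextArrow Z)^[p.length] b) := by
  have hpq := h.arrowList_eq_iterate hsp ((head?_arrowList_comp q hp).trans hb)
  rw [arrowList_comp, length_comp, List.iterate_add] at hpq
  rw [(List.append_inj hpq (by simp)).2]
  obtain ⟨m, hm⟩ := Nat.exists_eq_succ_of_ne_zero hq.ne'
  rw [hm]
  rfl

theorem exists_cycle_eq_comp (hsp : IsSpecialPair Z) {x y : V} {p : Path x y}
    (hp : IsZAdmissible Z p) {b : Total V} (hb : (arrowList p).head? = some b) {t : ℕ}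
    (ht : 0 < t) (htp : t < p.length) (hper : Function.IsPeriodicPt (nextArrow Z) t b) :
    ∃ (d : Path x x) (e : Path x y), p = d.comp e ∧ d.length = t := by
  obtain ⟨w, d, e, rfl, hd⟩ := p.exists_eq_comp_of_le_length htp.le
  have hd0 : 0 < d.length := hd ▸ ht
  rw [head?_arrowList_comp e hd0] at hb
  have he := hp.head?_right hsp hd0 (by rw [length_comp] at htp; omega) hb
  rw [hd, hper] at he
  obtain rfl : w = x := (left_of_head?_arrowList he).symm.trans (left_of_head?_arrowList hb)
  exact ⟨d, e, rfl, hd⟩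

/-- All the powers of the cycle `c` are admissible. -/
def PowersAdmissible (Z : Set (QPath V)) {x : V} (c : Path x x) : Prop :=
  ∀ m : ℕ, 0 < m → IsZAdmissible Z (cyclePow c m)

theorem PowersAdmissible.isZAdmissible {x : V} {c : Path x x} (h : PowersAdmissible Z c) :
    IsZAdmissible Z c := by
  simpa only [cyclePow_one] using h 1 one_pos

theorem PowersAdmissible.comp_self {x : V} {c : Path x x} (h : PowersAdmissible Z c) :
    IsZAdmissible Z (c.comp c) := by
  simpa only [cyclePow, nil_comp] using h 2 two_pos

theorem PowersAdmissible.isPeriodicPt (hsp : IsSpecialPair Z) {x : V} {c : Path x x}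
    (h : PowersAdmissible Z c) (hc : 0 < c.length) {b : Total V}
    (hb : (arrowList c).head? = some b) : Function.IsPeriodicPt (nextArrow Z) c.length b :=
  Option.some.inj ((h.comp_self.head?_right hsp hc hc hb).symm.trans hb)

end Admissible

/-! ### Primitive cycles -/

section PrimitiveCycles

open Quiver Quiver.Path

variable {V : Type u} [Quiver.{v} V] {Z : Set (QPath V)}

theorem IsPrimitiveCycle.powersAdmissible {x : V} {c : Path x x} (h : IsPrimitiveCycle Z c) :
    PowersAdmissible Z c :=
  h.admissible

theorem IsPrimitiveCycle.isZAdmissible {x : V} {c : Path x x} (h : IsPrimitiveCycle Z c) :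
    IsZAdmissible Z c :=
  h.powersAdmissible.isZAdmissible

theorem IsPrimitiveCycle.isPeriodicPt (hsp : IsSpecialPair Z) {x : V} {c : Path x x}
    (h : IsPrimitiveCycle Z c) {b : Total V} (hb : (arrowList c).head? = some b) :
    Function.IsPeriodicPt (nextArrow Z) c.length b :=
  h.powersAdmissible.isPeriodicPt hsp h.nontrivial hb

theorem IsPrimitiveCycle.length_eq (hsp : IsSpecialPair Z) {x : V} {c : Path x x}
    (h : IsPrimitiveCycle Z c) {b : Total V} (hb : (arrowList c).head? = some b) :
    c.length = Function.minimalPeriod (nextArrow Z) b := by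
  have hper := h.isPeriodicPt hsp hb
  obtain ⟨k, hk⟩ := hper.minimalPeriod_dvd
  have ht0 := hper.minimalPeriod_pos h.nontrivial
  have htp := Function.isPeriodicPt_minimalPeriod (nextArrow Z) b
  refine (hper.minimalPeriod_le h.nontrivial).antisymm' (not_lt.mp fun hlt => ?_)
  obtain ⟨d, e, rfl, hd⟩ := exists_cycle_eq_comp hsp h.isZAdmissible hb ht0 hlt htp
  rw [← hd] at ht0 hlt hk htp
  have hdadm := h.isZAdmissible.of_comp_left
  have hdb := (head?_arrowList_comp e ht0).symm.trans hb
  refine h.not_power ⟨d, ht0, hlt, hdadm, k, ?_, ?_⟩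
  · exact lt_of_mul_lt_mul_left (by rwa [mul_one, ← hk]) d.length.zero_le
  · apply arrowList_injective
    rw [arrowList_cyclePow (hdadm.arrowList_eq_iterate hsp hdb) htp,
      h.isZAdmissible.arrowList_eq_iterate hsp hb, hk, mul_comm]

theorem isPrimitiveCycle_of_length_eq (hsp : IsSpecialPair Z) {x : V} {c : Path x x}
    (h0 : 0 < c.length) (h : PowersAdmissible Z c) {b : Total V}
    (hb : (arrowList c).head? = some b)
    (hl : c.length = Function.minimalPeriod (nextArrow Z) b) : IsPrimitiveCycle Z c := by
  refine ⟨h0, h, ?_⟩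
  rintro ⟨d, hd0, hdl, -, k, hk, rfl⟩
  obtain ⟨k, rfl⟩ := Nat.exists_eq_add_of_le' hk
  have hadm := h.isZAdmissible
  rw [cyclePow_succ'] at hb hadm
  rw [head?_arrowList_comp _ hd0] at hb
  have hpow : 0 < (cyclePow d (k + 1)).length := by
    rw [length_cyclePow]
    positivity
  have hd := hadm.head?_right hsp hd0 hpow hb
  rw [cyclePow_succ', head?_arrowList_comp _ hd0, hb] at hd
  have hper : Function.IsPeriodicPt (nextArrow Z) d.length b := (Option.some.inj hd).symm
  exact (hper.minimalPeriod_le hd0).not_gt (hl ▸ hdl)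

theorem IsPrimitiveCycle.eq (hsp : IsSpecialPair Z) {x : V} {c d : Path x x}
    (hc : IsPrimitiveCycle Z c) (hd : IsPrimitiveCycle Z d)
    (h : (arrowList c).head? = (arrowList d).head?) : c = d := by
  obtain ⟨b, hb⟩ := exists_head?_arrowList hc.nontrivial
  exact hc.isZAdmissible.eq hsp hd.isZAdmissible h
    ((hc.length_eq hsp hb).trans (hd.length_eq hsp (h ▸ hb)).symm)

theorem finite_setOf_isPrimitiveCycle [Finite (Total V)] (hsp : IsSpecialPair Z) (x : V) :
    {c : Path x x | IsPrimitiveCycle Z c}.Finite :=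
  Set.Finite.of_injOn (f := fun c => (arrowList c).head?) (t := Set.univ) (Set.mapsTo_univ _ _)
    (fun _ hc _ hd h => IsPrimitiveCycle.eq hsp hc hd h) Set.finite_univ

theorem IsPrimitiveCycle.head?_eq (hsp : IsSpecialPair Z) {x y : V} {c : Path x x}
    (hc : IsPrimitiveCycle Z c) {p : Path x y} (hp : 0 < p.length)
    (h : IsZAdmissible Z (c.comp p)) : (arrowList c).head? = (arrowList p).head? := by
  obtain ⟨b, hb⟩ := exists_head?_arrowList hc.nontrivial
  rw [h.head?_right hsp hc.nontrivial hp hb, hc.isPeriodicPt hsp hb, hb]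

theorem IsPrimitiveCycle.eq_of_comp (hsp : IsSpecialPair Z) {x y : V} {c d : Path x x}
    (hc : IsPrimitiveCycle Z c) (hd : IsPrimitiveCycle Z d) {p : Path x y} (hp : 0 < p.length)
    (h : IsZAdmissible Z (c.comp p)) (h' : IsZAdmissible Z (d.comp p)) : c = d :=
  hc.eq hsp hd ((hc.head?_eq hsp hp h).trans (hd.head?_eq hsp hp h').symm)

theorem IsPrimitiveCycle.eq_of_toPath_comp (hsp : IsSpecialPair Z) {x y : V} {a : x ⟶ y}
    {c d : Path y y} (hc : IsPrimitiveCycle Z c) (hd : IsPrimitiveCycle Z d)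
    (h : IsZAdmissible Z (a.toPath.comp c)) (h' : IsZAdmissible Z (a.toPath.comp d)) :
    c = d := by
  obtain ⟨b, hb⟩ := exists_head?_arrowList hc.nontrivial
  obtain ⟨b', hb'⟩ := exists_head?_arrowList hd.nontrivial
  have hbb' : b = b' := (h.follows_getLast?_head? rfl hb).right_unique hsp
    (h'.follows_getLast?_head? rfl hb')
  exact hc.eq hsp hd (by rw [hb, hb', hbb'])

theorem IsPrimitiveCycle.comp_isZAdmissible (hsp : IsSpecialPair Z) {x y : V} {c : Path x x}
    (hc : IsPrimitiveCycle Z c) {p : Path x y} (hp : 0 < p.length) (hadm : IsZAdmissible Z p)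
    (h : (arrowList c).head? = (arrowList p).head?) : IsZAdmissible Z (c.comp p) := by
  obtain ⟨m, hm⟩ := Nat.exists_eq_succ_of_ne_zero hp.ne'
  have hhead : (arrowList p).head? = (arrowList (cyclePow c (m + 1))).head? := by
    rw [cyclePow_succ', head?_arrowList_comp _ hc.nontrivial, h]
  have hlen : p.length ≤ (cyclePow c (m + 1)).length := by
    rw [length_cyclePow, hm]
    exact Nat.le_mul_of_pos_right _ hc.nontrivial
  obtain ⟨r, hr⟩ := hadm.exists_eq_comp hsp (hc.admissible (m + 1) m.succ_pos) hp hhead hlen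
  have hpow := hc.admissible (m + 2) (Nat.succ_pos _)
  rw [cyclePow_succ', hr, ← comp_assoc] at hpow
  exact hpow.of_comp_left

theorem IsPrimitiveCycle.rotate (hsp : IsSpecialPair Z) {x y : V} {r : Path x y} {q : Path y x}
    (h : IsPrimitiveCycle Z (r.comp q)) : IsPrimitiveCycle Z (q.comp r) := by
  rcases Nat.eq_zero_or_pos r.length with h0 | h0
  · cases r with
    | nil => simpa using h
    | cons r e => simp at h0
  have hlen : (q.comp r).length = (r.comp q).length := by
    simp only [length_comp, add_comm]
  have hpos : 0 < (q.comp r).length := hlen ▸ h.nontrivial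
  have hpow : PowersAdmissible Z (q.comp r) := by
    intro m _
    have := h.admissible (m + 1) m.succ_pos
    rw [cyclePow_comp] at this
    exact this.of_comp_left.of_comp_right
  have hadm : IsZAdmissible Z (r.comp (q.comp r)) := by
    have := h.admissible 2 two_pos
    rw [cyclePow_comp, cyclePow_one] at this
    exact this.of_comp_left
  obtain ⟨b, hb⟩ := exists_head?_arrowList h0
  have hb' : (arrowList (r.comp q)).head? = some b := (head?_arrowList_comp q h0).trans hb
  refine isPrimitiveCycle_of_length_eq hsp hpos hpow (hadm.head?_right hsp h0 hpos hb) ?_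
  rw [Function.minimalPeriod_apply_iterate, hlen, h.length_eq hsp hb']
  exact ⟨_, h.nontrivial, h.isPeriodicPt hsp hb'⟩

theorem IsPrimitiveCycle.exists_comp_toPath (hsp : IsSpecialPair Z) {x y : V} {a : x ⟶ y}
    {c : Path x x} (hc : IsPrimitiveCycle Z c) (h : IsZAdmissible Z (c.comp a.toPath)) :
    ∃ q : Path y x, c = a.toPath.comp q ∧ IsPrimitiveCycle Z (q.comp a.toPath) := by
  obtain ⟨_, _, q, hab, rfl⟩ :=
    exists_toPath_comp_of_head?_arrowList (hc.head?_eq hsp (p := a.toPath) (by simp) h)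
  cases hab
  exact ⟨q, rfl, hc.rotate hsp⟩

theorem IsPrimitiveCycle.exists_toPath_comp (hsp : IsSpecialPair Z) {x y : V} {a : x ⟶ y}
    {c : Path y y} (hc : IsPrimitiveCycle Z c) (h : IsZAdmissible Z (a.toPath.comp c)) :
    ∃ q : Path y x, c = q.comp a.toPath ∧ IsPrimitiveCycle Z (a.toPath.comp q) := by
  obtain ⟨b, hb⟩ := exists_head?_arrowList hc.nontrivial
  obtain ⟨w, q, e, rfl⟩ := c.length_ne_zero_iff_eq_cons.mp hc.nontrivial.ne'
  have ha : Follows Z ⟨x, y, a⟩ b := h.follows_getLast?_head? rfl hb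
  have he : Follows Z ⟨w, y, e⟩ b :=
    hc.powersAdmissible.comp_self.follows_getLast?_head? (by simp) hb
  cases ha.left_unique hsp he
  exact ⟨q, rfl, IsPrimitiveCycle.rotate hsp (r := q) (q := a.toPath) hc⟩

/-- The arrow `b` is the first arrow of arbitrarily long admissible paths. -/
def ExtendsIndefinitely (Z : Set (QPath V)) (b : Total V) : Prop :=
  ∀ m : ℕ, ∃ (y : V) (p : Path b.left y),
    IsZAdmissible Z p ∧ m < p.length ∧ (arrowList p).head? = some b

theorem ExtendsIndefinitely.follows_iterate (hsp : IsSpecialPair Z) {b : Total V}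
    (h : ExtendsIndefinitely Z b) (i : ℕ) :
    Follows Z ((nextArrow Z)^[i] b) ((nextArrow Z)^[i + 1] b) := by
  obtain ⟨y, p, hp, hl, hb⟩ := h (i + 1)
  have hchain := hp.isChain
  rw [hp.arrowList_eq_iterate hsp hb, List.isChain_iff_getElem] at hchain
  have hi := hchain i (by simpa using hl)
  rwa [List.getElem_iterate, List.getElem_iterate] at hi

theorem ExtendsIndefinitely.mem_periodicPts (hsp : IsSpecialPair Z) [Finite (Total V)]
    {b : Total V} (h : ExtendsIndefinitely Z b) : b ∈ Function.periodicPts (nextArrow Z) := by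
  obtain ⟨i, j, hij, heq⟩ := Finite.exists_ne_map_eq_of_infinite fun i => (nextArrow Z)^[i] b
  wlog hlt : i < j generalizing i j
  · exact this j i hij.symm heq.symm (hij.lt_of_le' (not_lt.mp hlt))
  -- Each arrow follows at most one arrow, so the coincidence can be moved back to `i = 0`.
  clear hij
  induction i generalizing j with
  | zero => exact ⟨j, hlt, heq.symm⟩
  | succ i ih =>
    obtain ⟨j, rfl⟩ := Nat.exists_eq_succ_of_ne_zero (Nat.ne_zero_of_lt hlt)
    refine ih j ?_ (Nat.lt_of_succ_lt_succ hlt)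
    have hi := h.follows_iterate hsp i
    rw [heq] at hi
    exact hi.left_unique hsp (h.follows_iterate hsp j)

theorem ExtendsIndefinitely.powersAdmissible (hsp : IsSpecialPair Z) {b : Total V}
    (h : ExtendsIndefinitely Z b) {c : Path b.left b.left} (hc : IsZAdmissible Z c)
    (hc0 : 0 < c.length) (hb : (arrowList c).head? = some b)
    (hper : Function.IsPeriodicPt (nextArrow Z) c.length b) : PowersAdmissible Z c := by
  intro m hm
  obtain ⟨z, q, hq, hl, hqb⟩ := h (m * c.length)
  obtain ⟨w, d, r, rfl, hd⟩ := q.exists_eq_comp_of_le_length hl.le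
  rw [head?_arrowList_comp r (hd ▸ Nat.mul_pos hm hc0)] at hqb
  have heq : (⟨b.left, w, d⟩ : QPath V) = ⟨b.left, b.left, cyclePow c m⟩ := by
    apply mk_eq_of_arrowList_eq
    rw [arrowList_cyclePow (hc.arrowList_eq_iterate hsp hb) hper,
      hq.of_comp_left.arrowList_eq_iterate hsp hqb, hd]
  cases heq
  exact hq.of_comp_left

theorem ExtendsIndefinitely.exists_isPrimitiveCycle (hsp : IsSpecialPair Z) [Finite (Total V)]
    {b : Total V} (h : ExtendsIndefinitely Z b) :
    ∃ c : Path b.left b.left, IsPrimitiveCycle Z c ∧ (arrowList c).head? = some b := by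
  have ht0 := Function.minimalPeriod_pos_of_mem_periodicPts (h.mem_periodicPts hsp)
  have htp := Function.isPeriodicPt_minimalPeriod (nextArrow Z) b
  obtain ⟨y, p, hp, hl, hb⟩ := h (Function.minimalPeriod (nextArrow Z) b)
  obtain ⟨c, e, rfl, hc⟩ := exists_cycle_eq_comp hsp hp hb ht0 hl htp
  have hc0 : 0 < c.length := hc ▸ ht0
  rw [head?_arrowList_comp e hc0] at hb
  exact ⟨c, isPrimitiveCycle_of_length_eq hsp hc0
    (h.powersAdmissible hsp hp.of_comp_left hc0 hb (hc.symm ▸ htp)) hb hc, hb⟩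

theorem exists_length_bound_of_head?_eq (hsp : IsSpecialPair Z) [Finite (Total V)]
    (b : Total V) :
    ∃ h : ℕ, ∀ (y : V) (p : Path b.left y), IsZAdmissible Z p → (arrowList p).head? = some b →
      h < p.length →
      ∃ (c : Path b.left b.left) (q : Path b.left y),
        IsPrimitiveCycle Z c ∧ 0 < q.length ∧ p = c.comp q := by
  by_cases hb : ExtendsIndefinitely Z b
  · obtain ⟨c, hc, hcb⟩ := hb.exists_isPrimitiveCycle hsp
    refine ⟨c.length, fun y p hp hpb hl => ?_⟩
    obtain ⟨q, rfl⟩ := hc.isZAdmissible.exists_eq_comp hsp hp hc.nontrivial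
      (hcb.trans hpb.symm) hl.le
    rw [length_comp] at hl
    exact ⟨c, q, hc, Nat.pos_of_lt_add_right hl, rfl⟩
  · simp only [ExtendsIndefinitely, not_forall] at hb
    obtain ⟨m, hm⟩ := hb
    exact ⟨m, fun y p hp hpb hl => (hm ⟨y, p, hp, hl, hpb⟩).elim⟩

theorem exists_length_bound (hsp : IsSpecialPair Z) [Finite (Total V)] :
    ∃ h : ℕ, 0 < h ∧ ∀ (x y : V) (p : Path x y), IsZAdmissible Z p → h < p.length →
      ∃ (c : Path x x) (q : Path x y), IsPrimitiveCycle Z c ∧ 0 < q.length ∧ p = c.comp q := by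
  choose h hh using exists_length_bound_of_head?_eq (V := V) hsp
  obtain ⟨m, hm⟩ := (Set.finite_range h).bddAbove
  refine ⟨m + 1, m.succ_pos, fun x y p hp hl => ?_⟩
  obtain ⟨b, hb⟩ := exists_head?_arrowList (pos_of_gt hl)
  obtain rfl := left_of_head?_arrowList hb
  exact hh b y p hp hb ((hm (Set.mem_range_self b)).trans_lt (m.lt_succ_self.trans hl))

end PrimitiveCycles

/-! ### The primitive-nerve partition -/

section Nerve

open Quiver Quiver.Path

variable {V : Type u} [Quiver.{v} V] {Z : Set (QPath V)} {n : ℕ} {P : Fin n → Set V}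

theorem PrimRel.symm {x y : V} : PrimRel Z x y → PrimRel Z y x :=
  fun ⟨z, c, hc, hx, hy⟩ => ⟨z, c, hc, hy, hx⟩

theorem IsPrimitiveNervePartition.mem_iff_of_primRel (hP : IsPrimitiveNervePartition Z P)
    {x y : V} (h : PrimRel Z x y) (i : Fin n) : x ∈ P i ↔ y ∈ P i := by
  obtain ⟨w, -, hw⟩ : P i ∈ nerveParts Z := hP.range_eq ▸ Set.mem_range_self i
  rw [hw]
  exact ⟨fun hx => hx.tail h, fun hy => hy.tail h.symm⟩

theorem IsPrimitiveNervePartition.eq_of_mem (hP : IsPrimitiveNervePartition Z P)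
    {x : V} {i j : Fin n} (hi : x ∈ P i) (hj : x ∈ P j) : i = j := by
  have : Std.Symm (PrimRel Z) := ⟨fun _ _ => PrimRel.symm⟩
  apply hP.injective
  obtain ⟨v, -, hv⟩ : P i ∈ nerveParts Z := hP.range_eq ▸ Set.mem_range_self i
  obtain ⟨w, -, hw⟩ : P j ∈ nerveParts Z := hP.range_eq ▸ Set.mem_range_self j
  rw [hv] at hi ⊢
  rw [hw] at hj ⊢
  ext y
  exact ⟨fun hy => hj.trans ((symm hi).trans hy), fun hy => hi.trans ((symm hj).trans hy)⟩

theorem IsPrimitiveNervePartition.exists_mem (hP : IsPrimitiveNervePartition Z P)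
    {x : V} {c : Path x x} (hc : IsPrimitiveCycle Z c) : ∃ i, x ∈ P i := by
  have hx := start_mem_vertices c
  obtain ⟨i, hi⟩ : {y | Relation.TransGen (PrimRel Z) x y} ∈ Set.range P :=
    hP.range_eq ▸ ⟨x, ⟨x, c, hc, hx⟩, rfl⟩
  exact ⟨i, hi ▸ .single ⟨x, c, hc, hx, hx⟩⟩

theorem IsPrimitiveNervePartition.mem_iff_of_comp (hP : IsPrimitiveNervePartition Z P)
    {x y : V} {q : Path y x} {r : Path x y} (hc : IsPrimitiveCycle Z (r.comp q)) (i : Fin n) :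
    x ∈ P i ↔ y ∈ P i := by
  refine hP.mem_iff_of_primRel ⟨x, _, hc, start_mem_vertices _, ?_⟩ i
  rw [vertices_comp]
  exact List.mem_append_right _ (start_mem_vertices q)

end Nerve

/-! ### Regular sequences -/

section Regular

variable {R : Type w} [CommRing R] {n : ℕ} {s : Fin n → R}

/-- The ideal generated by the entries of `s` other than the `i`-th. -/
def spanExcept (s : Fin n → R) (i : Fin n) : Ideal R := Ideal.span (s '' {i}ᶜ)

theorem mem_spanExcept (s : Fin n → R) {i j : Fin n} (h : j ≠ i) : s j ∈ spanExcept s i :=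
  Ideal.subset_span ⟨j, h, rfl⟩

open RingTheory.Sequence in
theorem mem_spanExcept_of_mul_mem [IsLocalRing R] [IsNoetherianRing R]
    (hreg : IsRegular R (List.ofFn s)) {i : Fin n} {r : R} (h : r * s i ∈ spanExcept s i) :
    r ∈ spanExcept s i := by
  classical
  set l := ((List.finRange n).erase i).map s with hl
  have hspan : Ideal.ofList l = spanExcept s i := by
    rw [Ideal.ofList, spanExcept]
    congr 1
    ext y
    simp only [hl, List.mem_map, Set.mem_ofPred_eq, Set.mem_image, Set.mem_compl_iff,
      Set.mem_singleton_iff, (List.nodup_finRange n).mem_erase_iff, List.mem_finRange, and_true]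
  have hperm : (List.ofFn s).Perm (l ++ [s i]) := by
    rw [List.ofFn_eq_map, hl]
    exact ((List.perm_cons_erase (List.mem_finRange i)).map s).trans
      (List.perm_append_singleton _ _).symm
  have hreg' := (IsLocalRing.isRegular_of_perm hreg hperm).toIsWeaklyRegular
  rw [isWeaklyRegular_append_iff, isWeaklyRegular_singleton_iff, hspan,
    isSMulRegular_quotient_iff_mem_of_smul_mem] at hreg'
  simpa only [smul_eq_mul, Ideal.mul_top, mul_comm (s i), h, forall_const] using hreg'.2 r

theorem mem_spanExcept_of_sum_mul_eq_zero [IsLocalRing R] [IsNoetherianRing R]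
    (hreg : RingTheory.Sequence.IsRegular R (List.ofFn s)) {c : Fin n → R}
    (h : ∑ i, c i * s i = 0) (i : Fin n) : c i ∈ spanExcept s i := by
  classical
  refine mem_spanExcept_of_mul_mem hreg ?_
  rw [← Finset.add_sum_erase _ _ (Finset.mem_univ i)] at h
  rw [eq_neg_of_add_eq_zero_left h]
  exact neg_mem (Ideal.sum_mem _ fun j hj => Ideal.mul_mem_left _ _
    (mem_spanExcept s (Finset.ne_of_mem_erase hj)))

theorem span_range_ne_top (hreg : RingTheory.Sequence.IsRegular R (List.ofFn s)) :
    Ideal.span (Set.range s) ≠ ⊤ := by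
  have hrange : Ideal.ofList (List.ofFn s) = Ideal.span (Set.range s) := by
    simp only [Ideal.ofList, List.mem_ofFn]
    rfl
  have h := hreg.top_ne_smul
  rw [smul_eq_mul, Ideal.mul_top, hrange] at h
  exact h.symm

theorem pow_notMem_spanExcept [IsLocalRing R] [IsNoetherianRing R]
    (hreg : RingTheory.Sequence.IsRegular R (List.ofFn s)) (i : Fin n) (k : ℕ) :
    s i ^ k ∉ spanExcept s i := by
  induction k with
  | zero =>
    rw [pow_zero, ← Ideal.ne_top_iff_one]
    exact ne_top_of_le_ne_top (span_range_ne_top hreg)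
      (Ideal.span_mono (Set.image_subset_range s _))
  | succ k ih => exact fun h => ih (mem_spanExcept_of_mul_mem hreg (by rwa [← pow_succ]))

end Regular

/-! ### Spans of paths -/

namespace PathAlgebra

open Quiver Quiver.Path

variable (R : Type w) [CommRing R] {V : Type u} [Quiver.{v} V]

/-- The span of a set of paths in the path algebra. -/
noncomputable def pathSpan (S : Set (QPath V)) : Submodule R (PathAlgebra R V) :=
  Submodule.span R (ofPath R '' S)

variable {R} {S : Set (QPath V)}

theorem ofPath_mem_pathSpan {p : QPath V} (h : p ∈ S) : ofPath R p ∈ pathSpan R S :=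
  Submodule.subset_span ⟨p, h, rfl⟩

theorem pathSpan_le {X : Submodule R (PathAlgebra R V)} :
    pathSpan R S ≤ X ↔ ∀ p ∈ S, ofPath R p ∈ X :=
  Submodule.span_le.trans Set.image_subset_iff

theorem pathSpan_mono {T : Set (QPath V)} (h : S ⊆ T) : pathSpan R S ≤ pathSpan R T :=
  Submodule.span_mono (Set.image_mono h)

theorem mem_pathSpan_univ (u : PathAlgebra R V) : u ∈ pathSpan R (Set.univ : Set (QPath V)) := by
  induction u using induction_linear with
  | zero => exact zero_mem _
  | add u u' hu hu' => exact add_mem hu hu'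
  | smul r p => exact Submodule.smul_mem _ r (ofPath_mem_pathSpan (Set.mem_univ p))

theorem iSup_lengthSpan (L : Set ℕ) :
    ⨆ l ∈ L, lengthSpan R V l = pathSpan R {p : QPath V | p.length ∈ L} := by
  apply le_antisymm
  · refine iSup₂_le fun l hl => Submodule.span_le.mpr ?_
    rintro _ ⟨p, rfl, rfl⟩
    exact ofPath_mem_pathSpan hl
  · exact pathSpan_le.mpr fun p hp =>
      (le_iSup₂ (f := fun l (_ : l ∈ L) => lengthSpan R V l) p.length hp)
        (Submodule.subset_span ⟨p, rfl, rfl⟩)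

theorem arrowIdeal_eq_pathSpan : arrowIdeal R V = pathSpan R {p : QPath V | 0 < p.length} :=
  iSup_lengthSpan (Set.Ici 1)

theorem ofPath_mem_arrowIdeal {p : QPath V} (h : 0 < p.length) :
    ofPath R p ∈ arrowIdeal R V := by
  rw [arrowIdeal_eq_pathSpan]
  exact ofPath_mem_pathSpan h

theorem arrowIdeal_le {X : Submodule R (PathAlgebra R V)}
    (h : ∀ p : QPath V, 0 < p.length → ofPath R p ∈ X) : arrowIdeal R V ≤ X :=
  arrowIdeal_eq_pathSpan.trans_le (pathSpan_le.mpr h)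

theorem coord_ofPath_self (p : QPath V) : (basis R).coord p (ofPath R p) = 1 := by
  simp [ofPath]

theorem coord_ofPath_of_ne {p q : QPath V} (h : q ≠ p) :
    (basis R).coord p (ofPath R q) = 0 := by
  simp [ofPath, h]

theorem coord_eq_zero_of_mem_pathSpan {u : PathAlgebra R V} (hu : u ∈ pathSpan R S)
    {p : QPath V} (hp : p ∉ S) : (basis R).coord p u = 0 :=
  (pathSpan_le (X := LinearMap.ker ((basis R).coord p))).mpr
    (fun _ hq => coord_ofPath_of_ne (ne_of_mem_of_not_mem hq hp)) hu

theorem coord_triv_of_mem_arrowIdeal {u : PathAlgebra R V} (hu : u ∈ arrowIdeal R V) (x : V) :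
    (basis R).coord (QPath.triv x) u = 0 :=
  coord_eq_zero_of_mem_pathSpan (arrowIdeal_eq_pathSpan.le hu) (Nat.lt_irrefl 0)

theorem smul_mem_coeffIdeal {𝔞 : Ideal R} {r : R} (h : r ∈ 𝔞) (u : PathAlgebra R V) :
    r • u ∈ coeffIdeal 𝔞 V := by
  intro q
  rw [map_smul, Finsupp.smul_apply]
  exact 𝔞.mul_mem_right _ h

theorem coeffIdeal_le {𝔞 : Ideal R} {X : Submodule R (PathAlgebra R V)}
    (h : ∀ r ∈ 𝔞, ∀ p : QPath V, r • ofPath R p ∈ X) : coeffIdeal 𝔞 V ≤ X := by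
  intro u hu
  rw [← (basis R).linearCombination_repr u, Finsupp.linearCombination_apply]
  exact Submodule.sum_mem _ fun p _ => h _ (hu p) p

open Classical in
/-- The projection of the path algebra onto the span of a set of paths that annihilates all the
other paths. -/
noncomputable def proj (R : Type w) [CommRing R] (S : Set (QPath V)) :
    PathAlgebra R V →ₗ[R] PathAlgebra R V :=
  (basis R).constr R fun p => if p ∈ S then ofPath R p else 0

theorem proj_ofPath_of_mem {p : QPath V} (h : p ∈ S) : proj R S (ofPath R p) = ofPath R p := by
  rw [proj, ofPath, Module.Basis.constr_basis, if_pos h]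
  rfl

theorem proj_ofPath_of_notMem {p : QPath V} (h : p ∉ S) : proj R S (ofPath R p) = 0 := by
  rw [proj, ofPath, Module.Basis.constr_basis, if_neg h]

theorem proj_eq_self {u : PathAlgebra R V} (hu : u ∈ pathSpan R S) : proj R S u = u :=
  (pathSpan_le (X := LinearMap.eqLocus (proj R S) LinearMap.id)).mpr
    (fun _ hp => proj_ofPath_of_mem hp) hu

theorem proj_eq_zero {u : PathAlgebra R V} (hu : u ∈ pathSpan R Sᶜ) : proj R S u = 0 :=
  (pathSpan_le (X := LinearMap.ker (proj R S))).mpr (fun _ hp => proj_ofPath_of_notMem hp) hu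

variable [Fintype V]

theorem ofPath_mul_ofPath {x y z : V} (q : Path y z) (p : Path x y) :
    ofPath R ⟨y, z, q⟩ * ofPath R ⟨x, y, p⟩ = ofPath R ⟨x, z, p.comp q⟩ := by
  change mulLin R _ _ = _
  rw [mulLin_ofPath, pathMul, dif_pos rfl]
  simp [QPath.comp]

theorem ofPath_mul_ofPath_of_ne {p q : QPath V} (h : p.head ≠ q.tail) :
    ofPath R q * ofPath R p = 0 := by
  change mulLin R _ _ = _
  rw [mulLin_ofPath, pathMul, dif_neg h]

theorem ofPath_mul_e {x y : V} (p : Path x y) :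
    ofPath R ⟨x, y, p⟩ * e R x = ofPath R ⟨x, y, p⟩ := by
  rw [e, QPath.triv, ofPath_mul_ofPath, nil_comp]

theorem e_mul_ofPath {x y : V} (p : Path x y) :
    e R y * ofPath R ⟨x, y, p⟩ = ofPath R ⟨x, y, p⟩ := by
  rw [e, QPath.triv, ofPath_mul_ofPath, comp_nil]

theorem mul_mem_of_forall_ofPath_mul_mem {X : Submodule R (PathAlgebra R V)}
    {u : PathAlgebra R V} (h : ∀ p : QPath V, ofPath R p * u ∈ X) (w : PathAlgebra R V) :
    w * u ∈ X := by
  induction w using induction_linear with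
  | zero => exact (zero_mul u).symm ▸ X.zero_mem
  | add w w' hw hw' => exact (add_mul w w' u).symm ▸ X.add_mem hw hw'
  | smul r p => exact (smul_mul_assoc r (ofPath R p) u).symm ▸ X.smul_mem r (h p)

theorem mul_mem_of_forall_mul_ofPath_mem {X : Submodule R (PathAlgebra R V)}
    {u : PathAlgebra R V} (h : ∀ p : QPath V, u * ofPath R p ∈ X) (w : PathAlgebra R V) :
    u * w ∈ X := by
  induction w using induction_linear with
  | zero => exact (mul_zero u).symm ▸ X.zero_mem
  | add w w' hw hw' => exact (mul_add u w w').symm ▸ X.add_mem hw hw'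
  | smul r p => exact (mul_smul_comm r u (ofPath R p)).symm ▸ X.smul_mem r (h p)

theorem pathSpan_mul_pathSpan_le {S T U : Set (QPath V)}
    (h : ∀ ⦃x y z : V⦄ (q : Path y z) (p : Path x y), (⟨y, z, q⟩ : QPath V) ∈ S →
      (⟨x, y, p⟩ : QPath V) ∈ T → (⟨x, z, p.comp q⟩ : QPath V) ∈ U) :
    pathSpan R S * pathSpan R T ≤ pathSpan R U := by
  rw [pathSpan, pathSpan, Submodule.span_mul_span, Submodule.span_le]
  rintro _ ⟨_, ⟨⟨y, z, q⟩, hq, rfl⟩, _, ⟨⟨x, y', p⟩, hp, rfl⟩, rfl⟩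
  change ofPath R _ * ofPath R _ ∈ pathSpan R U
  by_cases hy : y' = y
  · subst hy
    rw [ofPath_mul_ofPath]
    exact ofPath_mem_pathSpan (h q p hq hp)
  · rw [ofPath_mul_ofPath_of_ne hy]
    exact zero_mem _

theorem ofPath_mem_arrowIdeal_sq {x y : V} {p : Path x y} (h : 2 ≤ p.length) :
    ofPath R ⟨x, y, p⟩ ∈ arrowIdeal R V ^ 2 := by
  obtain ⟨z, q, a, rfl⟩ := p.length_ne_zero_iff_eq_cons.mp (Nat.ne_zero_of_lt h)
  rw [← comp_toPath_eq_cons, ← ofPath_mul_ofPath, pow_two]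
  exact Submodule.mul_mem_mul (ofPath_mem_arrowIdeal Nat.one_pos)
    (ofPath_mem_arrowIdeal (Nat.le_of_succ_le_succ h))

theorem arrowIdeal_pow_le (m : ℕ) :
    arrowIdeal R V ^ m ≤ pathSpan R {p : QPath V | m ≤ p.length} := by
  induction m with
  | zero => exact fun u _ => pathSpan_mono (fun p _ => p.length.zero_le) (mem_pathSpan_univ u)
  | succ m ih =>
    rw [pow_succ]
    refine (mul_le_mul' ih arrowIdeal_eq_pathSpan.le).trans
      (pathSpan_mul_pathSpan_le fun x y z q p hq hp => ?_)
    simp only [Set.mem_ofPred_eq, QPath.length, length_comp] at hq hp ⊢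
    omega

end PathAlgebra

/-! ### Commutation of the relators with paths -/

section Relators

open Quiver Quiver.Path PathAlgebra

variable {R : Type w} [CommRing R] {V : Type u} [Quiver.{v} V] {Z : Set (QPath V)}

theorem sigma_mem {x : V} {X : Submodule R (PathAlgebra R V)}
    (h : ∀ c : Path x x, IsPrimitiveCycle Z c → ofPath R ⟨x, x, c⟩ ∈ X) : sigma R Z x ∈ X :=
  finsum_mem_induction (· ∈ X) X.zero_mem (fun _ _ => X.add_mem) h

theorem sigma_sub_ofPath_mem [Finite (Total V)] (hsp : IsSpecialPair Z) {x : V} {c : Path x x}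
    (hc : IsPrimitiveCycle Z c) {X : Submodule R (PathAlgebra R V)}
    (h : ∀ d : Path x x, IsPrimitiveCycle Z d → d ≠ c → ofPath R ⟨x, x, d⟩ ∈ X) :
    sigma R Z x - ofPath R ⟨x, x, c⟩ ∈ X := by
  classical
  have hfin := finite_setOf_isPrimitiveCycle hsp x
  have hmem : c ∈ hfin.toFinset := hfin.mem_toFinset.mpr hc
  rw [sigma, finsum_mem_eq_finite_toFinset_sum _ hfin, ← Finset.sum_erase_eq_sub hmem]
  refine X.sum_mem fun d hd => ?_
  rw [Finset.mem_erase, hfin.mem_toFinset] at hd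
  exact h d hd.2 hd.1

variable (R) in
/-- The span of the paths that are not `Z`-admissible. -/
noncomputable def nonadmissibleSpan (Z : Set (QPath V)) : Submodule R (PathAlgebra R V) :=
  pathSpan R {p | ¬ IsZAdmissible Z p.path}

open Classical in
/-- The element `r e_x - σ_x` if `x ∈ S`, and `r e_x` otherwise. For `S = P i` and `r = s i`, these
are the relations that generate `stringIdeal Z P s` together with `Z`. -/
noncomputable def relator (Z : Set (QPath V)) (S : Set V) (r : R) (x : V) : PathAlgebra R V :=
  r • e R x - if x ∈ S then sigma R Z x else 0

theorem ofPath_mem_nonadmissibleSpan {x y : V} {p : Path x y} (h : ¬ IsZAdmissible Z p) :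
    ofPath R ⟨x, y, p⟩ ∈ nonadmissibleSpan R Z :=
  ofPath_mem_pathSpan h

theorem coord_triv_relator (S : Set V) (r : R) (x y : V) :
    (basis R).coord (QPath.triv y) (relator Z S r x) =
      r * (basis R).coord (QPath.triv y) (e R x) := by
  rw [relator, map_sub, map_smul, smul_eq_mul, sub_eq_self]
  refine coord_triv_of_mem_arrowIdeal ?_ y
  split_ifs
  · exact sigma_mem fun c hc => ofPath_mem_arrowIdeal hc.nontrivial
  · exact zero_mem _

variable [Fintype V]

theorem mul_mem_nonadmissibleSpan_left (w : PathAlgebra R V) {u : PathAlgebra R V}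
    (hu : u ∈ nonadmissibleSpan R Z) : w * u ∈ nonadmissibleSpan R Z :=
  pathSpan_mul_pathSpan_le (S := Set.univ) (T := {p | ¬ IsZAdmissible Z p.path})
    (U := {p | ¬ IsZAdmissible Z p.path}) (fun _ _ _ _ _ _ hp h => hp h.of_comp_left)
    (Submodule.mul_mem_mul (mem_pathSpan_univ w) hu)

theorem mul_mem_nonadmissibleSpan_right (w : PathAlgebra R V) {u : PathAlgebra R V}
    (hu : u ∈ nonadmissibleSpan R Z) : u * w ∈ nonadmissibleSpan R Z :=
  pathSpan_mul_pathSpan_le (S := {p | ¬ IsZAdmissible Z p.path}) (T := Set.univ)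
    (U := {p | ¬ IsZAdmissible Z p.path}) (fun _ _ _ _ _ hq _ h => hq h.of_comp_right)
    (Submodule.mul_mem_mul hu (mem_pathSpan_univ w))

theorem e_mul_sigma (x : V) : e R x * sigma R Z x = sigma R Z x :=
  sigma_mem (X := LinearMap.eqLocus (LinearMap.mulLeft R (e R x)) LinearMap.id)
    fun c _ => e_mul_ofPath c

theorem sigma_mul_e (x : V) : sigma R Z x * e R x = sigma R Z x :=
  sigma_mem (X := LinearMap.eqLocus (LinearMap.mulRight R (e R x)) LinearMap.id)
    fun c _ => ofPath_mul_e c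

open Classical in
theorem ofPath_mul_relator (S : Set V) (r : R) {x y : V} (p : Path x y) :
    ofPath R ⟨x, y, p⟩ * relator Z S r x =
      r • ofPath R ⟨x, y, p⟩ - if x ∈ S then ofPath R ⟨x, y, p⟩ * sigma R Z x else 0 := by
  rw [relator, mul_sub, mul_smul_comm, ofPath_mul_e, mul_ite, mul_zero]

open Classical in
theorem relator_mul_ofPath (S : Set V) (r : R) {x y : V} (p : Path x y) :
    relator Z S r y * ofPath R ⟨x, y, p⟩ =
      r • ofPath R ⟨x, y, p⟩ - if y ∈ S then sigma R Z y * ofPath R ⟨x, y, p⟩ else 0 := by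
  rw [relator, sub_mul, smul_mul_assoc, e_mul_ofPath, ite_mul, zero_mul]

theorem e_mul_relator (S : Set V) (r : R) (x : V) :
    e R x * relator Z S r x = relator Z S r x := by
  rw [relator, mul_sub, mul_smul_comm, mul_ite, e_mul_sigma, mul_zero]
  exact congrArg (r • · - _) (e_mul_ofPath _)

theorem relator_mul_e (S : Set V) (r : R) (x : V) :
    relator Z S r x * e R x = relator Z S r x := by
  rw [relator, sub_mul, smul_mul_assoc, ite_mul, sigma_mul_e, zero_mul]
  exact congrArg (r • · - _) (ofPath_mul_e _)

theorem ofPath_mul_sigma_mem {x y : V} {p : Path x y}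
    (h : ∀ c : Path x x, IsPrimitiveCycle Z c → ¬ IsZAdmissible Z (c.comp p)) :
    ofPath R ⟨x, y, p⟩ * sigma R Z x ∈ nonadmissibleSpan R Z :=
  sigma_mem (X := (nonadmissibleSpan R Z).comap (LinearMap.mulLeft R (ofPath R ⟨x, y, p⟩)))
    fun c hc => by
      rw [Submodule.mem_comap, LinearMap.mulLeft_apply, ofPath_mul_ofPath]
      exact ofPath_mem_nonadmissibleSpan (h c hc)

theorem sigma_mul_ofPath_mem {x y : V} {p : Path x y}
    (h : ∀ c : Path y y, IsPrimitiveCycle Z c → ¬ IsZAdmissible Z (p.comp c)) :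
    sigma R Z y * ofPath R ⟨x, y, p⟩ ∈ nonadmissibleSpan R Z :=
  sigma_mem (X := (nonadmissibleSpan R Z).comap (LinearMap.mulRight R (ofPath R ⟨x, y, p⟩)))
    fun c hc => by
      rw [Submodule.mem_comap, LinearMap.mulRight_apply, ofPath_mul_ofPath]
      exact ofPath_mem_nonadmissibleSpan (h c hc)

variable [Finite (Total V)]

theorem ofPath_mul_sigma_sub_mem (hsp : IsSpecialPair Z) {x y : V} {p : Path x y}
    (hp : 0 < p.length) {c : Path x x} (hc : IsPrimitiveCycle Z c)
    (h : IsZAdmissible Z (c.comp p)) :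
    ofPath R ⟨x, y, p⟩ * sigma R Z x - ofPath R ⟨x, y, c.comp p⟩ ∈ nonadmissibleSpan R Z := by
  rw [← ofPath_mul_ofPath, ← mul_sub]
  refine sigma_sub_ofPath_mem (X := (nonadmissibleSpan R Z).comap (LinearMap.mulLeft R _))
    hsp hc fun d hd hdc => ?_
  rw [Submodule.mem_comap, LinearMap.mulLeft_apply, ofPath_mul_ofPath]
  exact ofPath_mem_nonadmissibleSpan fun h' => hdc (hd.eq_of_comp hsp hc hp h' h)

theorem sigma_mul_arrow_sub_mem (hsp : IsSpecialPair Z) {x y : V} {a : x ⟶ y} {c : Path y y}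
    (hc : IsPrimitiveCycle Z c) (h : IsZAdmissible Z (a.toPath.comp c)) :
    sigma R Z y * ofPath R ⟨x, y, a.toPath⟩ - ofPath R ⟨x, y, a.toPath.comp c⟩ ∈
      nonadmissibleSpan R Z := by
  rw [← ofPath_mul_ofPath, ← sub_mul]
  refine sigma_sub_ofPath_mem (X := (nonadmissibleSpan R Z).comap (LinearMap.mulRight R _))
    hsp hc fun d hd hdc => ?_
  rw [Submodule.mem_comap, LinearMap.mulRight_apply, ofPath_mul_ofPath]
  exact ofPath_mem_nonadmissibleSpan fun h' => hdc (hd.eq_of_toPath_comp hsp hc h' h)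

theorem ofPath_mul_sigma_sub_sigma_mul_mem (hsp : IsSpecialPair Z) {x y : V} {a : x ⟶ y}
    {q : Path y x} (hq : IsPrimitiveCycle Z (a.toPath.comp q)) :
    ofPath R ⟨x, y, a.toPath⟩ * sigma R Z x - sigma R Z y * ofPath R ⟨x, y, a.toPath⟩ ∈
      nonadmissibleSpan R Z := by
  have hadm : IsZAdmissible Z ((a.toPath.comp q).comp a.toPath) :=
    hq.comp_isZAdmissible hsp (by simp) hq.isZAdmissible.of_comp_left
      (head?_arrowList_comp _ (by simp))
  have hx := ofPath_mul_sigma_sub_mem (R := R) hsp (p := a.toPath) (by simp) hq hadm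
  rw [comp_assoc] at hx hadm
  have hy := sigma_mul_arrow_sub_mem (R := R) hsp (a := a) (hq.rotate hsp) hadm
  simpa only [sub_sub_sub_cancel_right] using sub_mem hx hy

theorem relator_mul_arrow_sub_mem (hsp : IsSpecialPair Z) {S : Set V}
    (hS : ∀ {x y : V} {p : Path x y} {q : Path y x}, IsPrimitiveCycle Z (p.comp q) →
      (x ∈ S ↔ y ∈ S)) (r : R) {x y : V} (a : x ⟶ y) :
    relator Z S r y * ofPath R ⟨x, y, a.toPath⟩ - ofPath R ⟨x, y, a.toPath⟩ * relator Z S r x ∈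
      nonadmissibleSpan R Z := by
  classical
  rw [relator_mul_ofPath, ofPath_mul_relator, sub_sub_sub_cancel_left]
  by_cases h : ∃ q : Path y x, IsPrimitiveCycle Z (a.toPath.comp q)
  · obtain ⟨q, hq⟩ := h
    by_cases hx : x ∈ S
    · rw [if_pos hx, if_pos ((hS hq).mp hx)]
      exact ofPath_mul_sigma_sub_sigma_mul_mem hsp hq
    · rw [if_neg hx, if_neg (mt (hS hq).mpr hx), sub_zero]
      exact zero_mem _
  -- No primitive cycle runs through `a`, so none has an admissible composition with `a`.
  · have hx := ofPath_mul_sigma_mem (R := R) (p := a.toPath) fun c hc hadm => by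
      obtain ⟨q, rfl, -⟩ := hc.exists_comp_toPath hsp hadm
      exact h ⟨q, hc⟩
    have hy := sigma_mul_ofPath_mem (R := R) (p := a.toPath) fun c hc hadm => by
      obtain ⟨q, -, hq⟩ := hc.exists_toPath_comp hsp hadm
      exact h ⟨q, hq⟩
    exact sub_mem (by split_ifs; exacts [hx, zero_mem _]) (by split_ifs; exacts [hy, zero_mem _])

theorem relator_mul_ofPath_sub_mem (hsp : IsSpecialPair Z) {S : Set V}
    (hS : ∀ {x y : V} {p : Path x y} {q : Path y x}, IsPrimitiveCycle Z (p.comp q) →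
      (x ∈ S ↔ y ∈ S)) (r : R) {x y : V} (p : Path x y) :
    relator Z S r y * ofPath R ⟨x, y, p⟩ - ofPath R ⟨x, y, p⟩ * relator Z S r x ∈
      nonadmissibleSpan R Z := by
  induction p with
  | nil =>
    change relator Z S r x * e R x - e R x * relator Z S r x ∈ _
    rw [relator_mul_e, e_mul_relator, sub_self]
    exact zero_mem _
  | cons p a ih =>
    rw [← comp_toPath_eq_cons, ← ofPath_mul_ofPath]
    have ha := mul_mem_nonadmissibleSpan_right (ofPath R ⟨_, _, p⟩)
      (relator_mul_arrow_sub_mem hsp hS r a)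
    have hp := mul_mem_nonadmissibleSpan_left (ofPath R ⟨_, _, a.toPath⟩) ih
    convert add_mem ha hp using 1
    simp only [mul_sub, sub_mul, mul_assoc, sub_add_sub_cancel]

end Relators

/-! ### The string ideal as a span of relations -/

section StringIdeal

open Quiver Quiver.Path PathAlgebra

variable {R : Type w} [CommRing R] {V : Type u} [Quiver.{v} V] [Fintype V]

theorem mem_idealSubmodule {I : TwoSidedIdeal (PathAlgebra R V)} {u : PathAlgebra R V} :
    u ∈ idealSubmodule I ↔ u ∈ I := by
  simp [idealSubmodule]

variable {Z : Set (QPath V)} {n : ℕ} {P : Fin n → Set V} {s : Fin n → R}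

/-- The span of the paths that are not `Z`-admissible and of the products of the relators of
`stringIdeal Z P s` with paths of length at least `m`. It is the ideal itself for `m = 0`, and its
intersection with `arrowIdeal R V` for `m = 1`. -/
noncomputable def relationSpan (Z : Set (QPath V)) (P : Fin n → Set V) (s : Fin n → R) (m : ℕ) :
    Submodule R (PathAlgebra R V) :=
  nonadmissibleSpan R Z ⊔ Submodule.span R
    {u | ∃ (i : Fin n) (x y : V) (p : Path x y), m ≤ p.length ∧
      u = ofPath R ⟨x, y, p⟩ * relator Z (P i) (s i) x}

theorem relationSpan_le {m : ℕ} {X : Submodule R (PathAlgebra R V)}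
    (hZ : nonadmissibleSpan R Z ≤ X)
    (h : ∀ (i : Fin n) ⦃x y : V⦄ (p : Path x y), m ≤ p.length →
      ofPath R ⟨x, y, p⟩ * relator Z (P i) (s i) x ∈ X) :
    relationSpan Z P s m ≤ X := by
  refine sup_le hZ (Submodule.span_le.mpr ?_)
  rintro _ ⟨i, x, y, p, hp, rfl⟩
  exact h i p hp

theorem nonadmissibleSpan_le_relationSpan (m : ℕ) :
    nonadmissibleSpan R Z ≤ relationSpan Z P s m :=
  le_sup_left

theorem ofPath_mul_relator_mem_relationSpan (i : Fin n) {m : ℕ} {x y : V} {p : Path x y}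
    (hp : m ≤ p.length) :
    ofPath R ⟨x, y, p⟩ * relator Z (P i) (s i) x ∈ relationSpan Z P s m :=
  Submodule.mem_sup_right (Submodule.subset_span ⟨i, x, y, p, hp, rfl⟩)

theorem ofPath_mul_relator_of_ne {S : Set V} {r : R} {p : QPath V} {x : V} (h : x ≠ p.tail) :
    ofPath R p * relator Z S r x = 0 := by
  rw [← e_mul_relator, ← mul_assoc, e, ofPath_mul_ofPath_of_ne h, zero_mul]

theorem relator_mul_ofPath_of_ne {S : Set V} {r : R} {p : QPath V} {x : V} (h : p.head ≠ x) :
    relator Z S r x * ofPath R p = 0 := by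
  rw [← relator_mul_e, mul_assoc, e, ofPath_mul_ofPath_of_ne h, mul_zero]

theorem mul_relator_mem_relationSpan (w : PathAlgebra R V) (i : Fin n) (x : V) :
    w * relator Z (P i) (s i) x ∈ relationSpan Z P s 0 := by
  refine mul_mem_of_forall_ofPath_mul_mem (fun p => ?_) w
  obtain ⟨y, z, p⟩ := p
  by_cases h : x = y
  · subst h
    exact ofPath_mul_relator_mem_relationSpan i (Nat.zero_le _)
  · rw [ofPath_mul_relator_of_ne h]
    exact zero_mem _

theorem mul_mem_relationSpan_left (w : PathAlgebra R V) {u : PathAlgebra R V}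
    (hu : u ∈ relationSpan Z P s 0) : w * u ∈ relationSpan Z P s 0 := by
  refine relationSpan_le (X := (relationSpan Z P s 0).comap (LinearMap.mulLeft R w))
    (fun u hu => nonadmissibleSpan_le_relationSpan 0 (mul_mem_nonadmissibleSpan_left w hu))
    (fun i x y p _ => ?_) hu
  rw [Submodule.mem_comap, LinearMap.mulLeft_apply, ← mul_assoc]
  exact mul_relator_mem_relationSpan _ i x

theorem relator_mem_stringIdeal (i : Fin n) (x : V) :
    relator Z (P i) (s i) x ∈ stringIdeal Z P s := by
  refine (le_sup_right : _ ≤ stringIdeal Z P s) (le_iSup (fun i : Fin n =>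
    TwoSidedIdeal.span {y | ∃ x ∈ P i, y = s i • e R x - sigma R Z x} ⊔
      TwoSidedIdeal.span {y | ∃ x ∉ P i, y = s i • e R x}) i ?_)
  by_cases hx : x ∈ P i
  · rw [relator, if_pos hx]
    exact TwoSidedIdeal.mem_sup_left (TwoSidedIdeal.subset_span ⟨x, hx, rfl⟩)
  · rw [relator, if_neg hx, sub_zero]
    exact TwoSidedIdeal.mem_sup_right (TwoSidedIdeal.subset_span ⟨x, hx, rfl⟩)

theorem nonadmissibleSpan_le_stringIdeal :
    nonadmissibleSpan R Z ≤ idealSubmodule (stringIdeal Z P s) := by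
  refine pathSpan_le.mpr fun p hp => mem_idealSubmodule.mpr ?_
  obtain ⟨x, y, p⟩ := p
  obtain ⟨z, hz, a, b, rfl⟩ : ∃ z ∈ Z, ∃ a b, p = (Path.comp a z.path).comp b := not_not.mp hp
  rw [← ofPath_mul_ofPath, ← ofPath_mul_ofPath]
  exact TwoSidedIdeal.mul_mem_left _ _ _ (TwoSidedIdeal.mul_mem_right _ _ _
    (TwoSidedIdeal.mem_sup_left (TwoSidedIdeal.subset_span ⟨z, hz, rfl⟩)))

theorem relationSpan_le_stringIdeal (m : ℕ) :
    relationSpan Z P s m ≤ idealSubmodule (stringIdeal Z P s) :=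
  relationSpan_le nonadmissibleSpan_le_stringIdeal fun i x _ _ _ =>
    mem_idealSubmodule.mpr (TwoSidedIdeal.mul_mem_left _ _ _ (relator_mem_stringIdeal i x))

theorem stringIdeal_le {J : TwoSidedIdeal (PathAlgebra R V)} (hZ : ∀ z ∈ Z, ofPath R z ∈ J)
    (h : ∀ i x, relator Z (P i) (s i) x ∈ J) : stringIdeal Z P s ≤ J := by
  refine sup_le (TwoSidedIdeal.span_le.mpr (Set.image_subset_iff.mpr hZ)) (iSup_le fun i =>
    sup_le (TwoSidedIdeal.span_le.mpr ?_) (TwoSidedIdeal.span_le.mpr ?_))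
  all_goals
    rintro _ ⟨x, hx, rfl⟩
    simpa only [relator, hx, if_true, if_false, sub_zero, SetLike.mem_coe] using h i x

theorem relationSpan_one_le_arrowIdeal (hZ : ∀ z ∈ Z, 2 ≤ z.length) :
    relationSpan Z P s 1 ≤ arrowIdeal R V := by
  refine relationSpan_le (pathSpan_le.mpr fun p hp => ofPath_mem_arrowIdeal
    (two_pos.trans_le (two_le_length_of_not_isZAdmissible hZ hp))) fun i x y p hp => ?_
  rw [ofPath_mul_relator]
  refine sub_mem (Submodule.smul_mem _ _ (ofPath_mem_arrowIdeal hp)) ?_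
  split_ifs
  · refine sigma_mem (X := (arrowIdeal R V).comap (LinearMap.mulLeft R _)) fun c _ => ?_
    rw [Submodule.mem_comap, LinearMap.mulLeft_apply, ofPath_mul_ofPath]
    exact ofPath_mem_arrowIdeal (hp.trans (by simp [QPath.length]))
  · exact zero_mem _

theorem relationSpan_zero_le : relationSpan Z P s 0 ≤ relationSpan Z P s 1 ⊔
    Submodule.span R (Set.range fun k : Fin n × V => relator Z (P k.1) (s k.1) k.2) := by
  refine relationSpan_le ((nonadmissibleSpan_le_relationSpan 1).trans le_sup_left)
    fun i x y p _ => ?_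
  obtain hp | hp := p.length.eq_zero_or_pos
  · obtain rfl := eq_of_length_zero p hp
    obtain rfl := Path.eq_nil_of_length_zero p hp
    exact Submodule.mem_sup_right (Submodule.subset_span ⟨(i, x), (e_mul_relator _ _ _).symm⟩)
  · exact Submodule.mem_sup_left (ofPath_mul_relator_mem_relationSpan i hp)

theorem smul_sigma_mem_relationSpan (hP : IsPrimitiveNervePartition Z P) {i : Fin n} {x : V}
    (hx : x ∈ P i) {r : R} (hr : r ∈ spanExcept s i) :
    r • sigma R Z x ∈ relationSpan Z P s 1 := by
  refine Ideal.span_le (I := ((relationSpan Z P s 1).comap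
    (LinearMap.toSpanSingleton R _ (sigma R Z x)))).mpr ?_ hr
  rintro _ ⟨j, hj, rfl⟩
  refine sigma_mem (X := (relationSpan Z P s 1).comap (LinearMap.lsmul R _ (s j))) fun c hc => ?_
  have hxj : x ∉ P j := fun h => hj (hP.eq_of_mem h hx)
  have hc' := ofPath_mul_relator_mem_relationSpan (Z := Z) (P := P) (s := s) j hc.nontrivial
  rwa [ofPath_mul_relator, if_neg hxj, sub_zero] at hc'

theorem sum_coeff_mul_eq_zero {c : Fin n × V → R}
    (hc : ∑ k, c k • relator Z (P k.1) (s k.1) k.2 ∈ arrowIdeal R V) (x : V) :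
    ∑ i, c (i, x) * s i = 0 := by
  have h := coord_triv_of_mem_arrowIdeal hc x
  rw [map_sum, Fintype.sum_prod_type] at h
  rw [← h]
  refine Finset.sum_congr rfl fun i _ => ?_
  rw [Finset.sum_eq_single_of_mem x (Finset.mem_univ x) fun y _ hy => ?_]
  · rw [map_smul, coord_triv_relator, e, coord_ofPath_self, mul_one, smul_eq_mul]
  · rw [map_smul, coord_triv_relator, e, coord_ofPath_of_ne (mt (congrArg QPath.tail) hy),
      mul_zero, smul_zero]

theorem sum_smul_relator_mem_relationSpan [IsLocalRing R] [IsNoetherianRing R]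
    (hP : IsPrimitiveNervePartition Z P)
    (hreg : RingTheory.Sequence.IsRegular R (List.ofFn s)) {c : Fin n → R}
    (h : ∑ i, c i * s i = 0) (x : V) :
    ∑ i, c i • relator Z (P i) (s i) x ∈ relationSpan Z P s 1 := by
  classical
  simp only [relator, smul_sub, smul_smul, Finset.sum_sub_distrib, ← Finset.sum_smul, h, zero_smul,
    zero_sub, smul_ite, smul_zero]
  refine neg_mem (Submodule.sum_mem _ fun i _ => ?_)
  split_ifs with hx
  · exact smul_sigma_mem_relationSpan hP hx (mem_spanExcept_of_sum_mul_eq_zero hreg h i)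
  · exact zero_mem _

variable [Finite (Total V)]

theorem relator_mul_mem_relationSpan (hsp : IsSpecialPair Z) (hP : IsPrimitiveNervePartition Z P)
    (i : Fin n) (x : V) (w : PathAlgebra R V) :
    relator Z (P i) (s i) x * w ∈ relationSpan Z P s 0 := by
  refine mul_mem_of_forall_mul_ofPath_mem (fun p => ?_) w
  obtain ⟨z, y, p⟩ := p
  by_cases h : y = x
  · subst h
    rw [← sub_add_cancel (_ * _) (ofPath R ⟨z, y, p⟩ * relator Z (P i) (s i) z)]
    exact add_mem (nonadmissibleSpan_le_relationSpan 0 (relator_mul_ofPath_sub_mem hsp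
      (fun hc => hP.mem_iff_of_comp hc i) (s i) p)) (mul_relator_mem_relationSpan _ i z)
  · rw [relator_mul_ofPath_of_ne h]
    exact zero_mem _

theorem mul_mem_relationSpan_right (hsp : IsSpecialPair Z) (hP : IsPrimitiveNervePartition Z P)
    (w : PathAlgebra R V) {u : PathAlgebra R V} (hu : u ∈ relationSpan Z P s 0) :
    u * w ∈ relationSpan Z P s 0 := by
  refine relationSpan_le (X := (relationSpan Z P s 0).comap (LinearMap.mulRight R w))
    (fun u hu => ?_) (fun i x y p _ => ?_) hu
  all_goals rw [Submodule.mem_comap, LinearMap.mulRight_apply]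
  · exact nonadmissibleSpan_le_relationSpan 0 (mul_mem_nonadmissibleSpan_right w hu)
  · rw [mul_assoc]
    exact mul_mem_relationSpan_left _ (relator_mul_mem_relationSpan hsp hP i x w)

theorem idealSubmodule_stringIdeal (hsp : IsSpecialPair Z) (hP : IsPrimitiveNervePartition Z P) :
    idealSubmodule (stringIdeal Z P s) = relationSpan Z P s 0 := by
  refine le_antisymm (fun u hu => ?_) (relationSpan_le_stringIdeal 0)
  let J : TwoSidedIdeal (PathAlgebra R V) := TwoSidedIdeal.mk' (relationSpan Z P s 0 : Set _)
    (zero_mem _) add_mem neg_mem (mul_mem_relationSpan_left _)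
    (mul_mem_relationSpan_right hsp hP _)
  have hJ (u) : u ∈ J ↔ u ∈ relationSpan Z P s 0 := TwoSidedIdeal.mem_mk' ..
  have hle : stringIdeal Z P s ≤ J := by
    refine stringIdeal_le (fun z hz => (hJ _).mpr ?_) fun i x => (hJ _).mpr ?_
    · exact nonadmissibleSpan_le_relationSpan 0
        (ofPath_mem_nonadmissibleSpan (not_isZAdmissible_of_mem hz))
    · exact one_mul (relator Z (P i) (s i) x) ▸ mul_relator_mem_relationSpan 1 i x
  exact (hJ u).mp (hle (mem_idealSubmodule.mp hu))

theorem idealSubmodule_stringIdeal_inf_arrowIdeal [IsLocalRing R] [IsNoetherianRing R]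
    (hZ : ∀ z ∈ Z, 2 ≤ z.length) (hsp : IsSpecialPair Z) (hP : IsPrimitiveNervePartition Z P)
    (hreg : RingTheory.Sequence.IsRegular R (List.ofFn s)) :
    idealSubmodule (stringIdeal Z P s) ⊓ arrowIdeal R V = relationSpan Z P s 1 := by
  refine le_antisymm ?_
    (le_inf (relationSpan_le_stringIdeal 1) (relationSpan_one_le_arrowIdeal hZ))
  rintro u ⟨hI, hA⟩
  rw [SetLike.mem_coe, idealSubmodule_stringIdeal hsp hP] at hI
  obtain ⟨w, hw, t, ht, rfl⟩ := Submodule.mem_sup.mp (relationSpan_zero_le hI)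
  obtain ⟨c, rfl⟩ := (Submodule.mem_span_range_iff_exists_fun R).mp ht
  have hcA := (Submodule.add_mem_iff_right _ (relationSpan_one_le_arrowIdeal hZ hw)).mp hA
  refine add_mem hw ?_
  rw [Fintype.sum_prod_type_right]
  exact Submodule.sum_mem _ fun x _ =>
    sum_smul_relator_mem_relationSpan hP hreg (sum_coeff_mul_eq_zero hcA x) x

theorem smul_ofPath_sub_mem_relationSpan (hsp : IsSpecialPair Z) {i : Fin n} {x y : V}
    {p : Path x y} (hp : 0 < p.length) (hx : x ∈ P i) {c : Path x x} (hc : IsPrimitiveCycle Z c)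
    (h : IsZAdmissible Z (c.comp p)) :
    s i • ofPath R ⟨x, y, p⟩ - ofPath R ⟨x, y, c.comp p⟩ ∈ relationSpan Z P s 1 := by
  have hrel : ofPath R ⟨x, y, p⟩ * relator Z (P i) (s i) x ∈ relationSpan Z P s 1 :=
    ofPath_mul_relator_mem_relationSpan i hp
  have hσ : ofPath R ⟨x, y, p⟩ * sigma R Z x - ofPath R ⟨x, y, c.comp p⟩ ∈ nonadmissibleSpan R Z :=
    ofPath_mul_sigma_sub_mem hsp hp hc h
  rw [ofPath_mul_relator, if_pos hx] at hrel
  have hsum := add_mem hrel (nonadmissibleSpan_le_relationSpan 1 hσ)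
  rwa [sub_add_sub_cancel] at hsum

end StringIdeal

/-! ### Admissible paths do not lie in the string ideal -/

section NonMembership

open Quiver Quiver.Path PathAlgebra

variable {R : Type w} [CommRing R] {V : Type u} [Quiver.{v} V] {Z : Set (QPath V)}

open Classical in
/-- The functional that sends a `Z`-admissible path with the same first arrow as `c` to `t ^ k`,
where `k` is the number of times it runs through `c`, and any other path to zero. -/
noncomputable def windingFunctional (Z : Set (QPath V)) {x : V} (c : Path x x) (t : R) :
    PathAlgebra R V →ₗ[R] R :=
  (basis R).constr R fun q =>
    if IsZAdmissible Z q.path ∧ (arrowList q.path).head? = (arrowList c).head? then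
      t ^ (q.length / c.length) else 0

section

variable {x y z : V} {c : Path x x} {t : R} {q : Path y z}

theorem windingFunctional_of_head?_eq (hq : IsZAdmissible Z q)
    (h : (arrowList q).head? = (arrowList c).head?) :
    windingFunctional Z c t (ofPath R ⟨y, z, q⟩) = t ^ (q.length / c.length) := by
  rw [windingFunctional, ofPath, Module.Basis.constr_basis, if_pos ⟨hq, h⟩]
  rfl

theorem windingFunctional_eq_zero
    (h : IsZAdmissible Z q → (arrowList q).head? ≠ (arrowList c).head?) :
    windingFunctional Z c t (ofPath R ⟨y, z, q⟩) = 0 := by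
  rw [windingFunctional, ofPath, Module.Basis.constr_basis, if_neg fun h' => h h'.1 h'.2]

theorem windingFunctional_of_mem_nonadmissibleSpan {u : PathAlgebra R V}
    (hu : u ∈ nonadmissibleSpan R Z) : windingFunctional Z c t u = 0 :=
  (pathSpan_le (X := LinearMap.ker (windingFunctional Z c t))).mpr
    (fun _ hp => windingFunctional_eq_zero fun h => (hp h).elim) hu

variable [Fintype V] [Finite (Total V)]

theorem windingFunctional_ofPath_mul_sigma (hsp : IsSpecialPair Z) (hc : IsPrimitiveCycle Z c)
    (hq : 0 < q.length) :
    windingFunctional Z c t (ofPath R ⟨y, z, q⟩ * sigma R Z y) =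
      t * windingFunctional Z c t (ofPath R ⟨y, z, q⟩) := by
  by_cases h : IsZAdmissible Z q ∧ (arrowList q).head? = (arrowList c).head?
  · obtain ⟨hadm, hhead⟩ := h
    obtain rfl := left_eq_of_head?_arrowList_eq hq hhead
    have hcq := hc.comp_isZAdmissible hsp hq hadm hhead.symm
    have hσ := windingFunctional_of_mem_nonadmissibleSpan (c := c) (t := t)
      (ofPath_mul_sigma_sub_mem (R := R) hsp hq hc hcq)
    rw [map_sub, sub_eq_zero] at hσ
    rw [hσ, windingFunctional_of_head?_eq hcq (head?_arrowList_comp q hc.nontrivial),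
      windingFunctional_of_head?_eq hadm hhead, length_comp,
      Nat.add_div_left _ hc.nontrivial, pow_succ']
  · rw [windingFunctional_eq_zero (not_and.mp h), mul_zero, ← LinearMap.mulLeft_apply (R := R),
      ← LinearMap.comp_apply, ← LinearMap.mem_ker]
    refine sigma_mem fun d hd => ?_
    rw [LinearMap.mem_ker, LinearMap.comp_apply, LinearMap.mulLeft_apply, ofPath_mul_ofPath]
    refine windingFunctional_eq_zero fun hdq hhead => h ⟨hdq.of_comp_right, ?_⟩
    rw [← hd.head?_eq hsp hq hdq, ← head?_arrowList_comp q hd.nontrivial, hhead]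

end

variable [Fintype V] {n : ℕ} {P : Fin n → Set V} {s : Fin n → R}

theorem coord_mem_span_range_of_mem_relationSpan {x y : V} {p : Path x y}
    (hadm : IsZAdmissible Z p)
    (h : ∀ (c : Path x x) (q : Path x y), IsPrimitiveCycle Z c → p ≠ c.comp q)
    {u : PathAlgebra R V} (hu : u ∈ relationSpan Z P s 0) :
    (basis R).coord ⟨x, y, p⟩ u ∈ Ideal.span (Set.range s) := by
  refine relationSpan_le (X := ((Ideal.span (Set.range s)).restrictScalars R).comap
    ((basis R).coord ⟨x, y, p⟩)) (fun u hu => ?_) (fun i x' y' q _ => ?_) hu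
  · rw [Submodule.mem_comap, coord_eq_zero_of_mem_pathSpan hu (not_not.mpr hadm)]
    exact zero_mem _
  have hσ : (basis R).coord ⟨x, y, p⟩ (ofPath R ⟨x', y', q⟩ * sigma R Z x') = 0 := by
    rw [← LinearMap.mulLeft_apply (R := R), ← LinearMap.comp_apply, ← LinearMap.mem_ker]
    refine sigma_mem fun c hc => ?_
    rw [LinearMap.mem_ker, LinearMap.comp_apply, LinearMap.mulLeft_apply, ofPath_mul_ofPath]
    refine coord_ofPath_of_ne fun heq => ?_
    cases heq
    exact h c q hc rfl
  rw [Submodule.mem_comap, ofPath_mul_relator, map_sub, map_smul,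
    apply_ite ((basis R).coord _), hσ, map_zero, ite_self, sub_zero]
  exact Ideal.mul_mem_right _ _ (Ideal.subset_span (Set.mem_range_self i))

variable [Finite (Total V)]

theorem windingFunctional_mem_spanExcept (hsp : IsSpecialPair Z)
    (hP : IsPrimitiveNervePartition Z P) {i : Fin n} {x : V} (hx : x ∈ P i) {c : Path x x}
    (hc : IsPrimitiveCycle Z c) {u : PathAlgebra R V} (hu : u ∈ relationSpan Z P s 1) :
    windingFunctional Z c (s i) u ∈ spanExcept s i := by
  refine relationSpan_le
    (X := ((spanExcept s i).restrictScalars R).comap (windingFunctional Z c (s i)))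
    (fun u hu => ?_) (fun j y z q hq => ?_) hu
  · rw [Submodule.mem_comap, windingFunctional_of_mem_nonadmissibleSpan hu]
    exact zero_mem _
  rw [Submodule.mem_comap, ofPath_mul_relator, map_sub, map_smul, smul_eq_mul]
  by_cases h : IsZAdmissible Z q ∧ (arrowList q).head? = (arrowList c).head?
  · obtain rfl := left_eq_of_head?_arrowList_eq hq h.2
    obtain rfl | hji := eq_or_ne j i
    · rw [if_pos hx, windingFunctional_ofPath_mul_sigma hsp hc hq, sub_self]
      exact zero_mem _
    · rw [if_neg fun hy => hji (hP.eq_of_mem hy hx), map_zero, sub_zero]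
      exact Ideal.mul_mem_right _ _ (mem_spanExcept s hji)
  · rw [windingFunctional_eq_zero (not_and.mp h), mul_zero, zero_sub, apply_ite
      (windingFunctional Z c (s i)), windingFunctional_ofPath_mul_sigma hsp hc hq,
      windingFunctional_eq_zero (not_and.mp h), mul_zero, map_zero, ite_self, neg_zero]
    exact zero_mem _

theorem ofPath_notMem_stringIdeal [IsLocalRing R] [IsNoetherianRing R]
    (hZ : ∀ z ∈ Z, 2 ≤ z.length) (hsp : IsSpecialPair Z) (hP : IsPrimitiveNervePartition Z P)
    (hreg : RingTheory.Sequence.IsRegular R (List.ofFn s)) {p : QPath V}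
    (hp : IsZAdmissible Z p.path) :
    ofPath R p ∉ stringIdeal Z P s := by
  obtain ⟨x, y, p⟩ := p
  intro hI
  rw [← mem_idealSubmodule] at hI
  by_cases h : ∃ (c : Path x x) (q : Path x y), IsPrimitiveCycle Z c ∧ p = c.comp q
  · obtain ⟨c, q, hc, rfl⟩ := h
    obtain ⟨i, hi⟩ := hP.exists_mem hc
    have hA : ofPath R ⟨x, y, c.comp q⟩ ∈ arrowIdeal R V :=
      ofPath_mem_arrowIdeal (hc.nontrivial.trans_le (by simp [QPath.length]))
    have hω := windingFunctional_mem_spanExcept hsp hP hi hc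
      ((idealSubmodule_stringIdeal_inf_arrowIdeal hZ hsp hP hreg).le ⟨hI, hA⟩)
    rw [windingFunctional_of_head?_eq hp (head?_arrowList_comp q hc.nontrivial)] at hω
    exact pow_notMem_spanExcept hreg i _ hω
  · have hcoord := coord_mem_span_range_of_mem_relationSpan hp
      (fun c q hc hpq => h ⟨c, q, hc, hpq⟩) ((idealSubmodule_stringIdeal hsp hP).le hI)
    rw [coord_ofPath_self, ← Ideal.eq_top_iff_one] at hcoord
    exact span_range_ne_top hreg hcoord

end NonMembership

/-! ### The string algebra -/

section StringAlgebra

open Quiver Quiver.Path PathAlgebra IsLocalRing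

variable {R : Type w} [CommRing R] {V : Type u} [Quiver.{v} V] [Fintype V]
  {Z : Set (QPath V)} {n : ℕ} {P : Fin n → Set V} {s : Fin n → R}

theorem isSpecialIdeal_stringIdeal (hsp : IsSpecialPair Z) :
    IsSpecialIdeal (stringIdeal Z P s) := by
  have notMem {x y z : V} {a : y ⟶ z} {b : x ⟶ y}
      (hab : arrow R a * arrow R b ∉ stringIdeal Z P s) : QPath.ofArrows a b ∉ Z := by
    refine fun hZ => hab ?_
    rw [arrow, arrow, QPath.ofArrow, QPath.ofArrow, ofPath_mul_ofPath, ← mem_idealSubmodule]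
    exact nonadmissibleSpan_le_stringIdeal
      (ofPath_mem_nonadmissibleSpan (not_isZAdmissible_of_mem hZ))
  exact ⟨fun x y b => (hsp.1 x y b).anti fun a ha => notMem ha,
    fun x y b => (hsp.2 x y b).anti fun c hc => notMem hc⟩

theorem relator_mem_arrowIdeal_sup_coeffIdeal (S : Set V) {𝔞 : Ideal R} {r : R} (hr : r ∈ 𝔞)
    (x : V) : relator Z S r x ∈ arrowIdeal R V ⊔ coeffIdeal 𝔞 V := by
  refine sub_mem (Submodule.mem_sup_right (smul_mem_coeffIdeal hr _)) (Submodule.mem_sup_left ?_)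
  split_ifs
  · exact sigma_mem fun c hc => ofPath_mem_arrowIdeal hc.nontrivial
  · exact zero_mem _

theorem relationSpan_one_le_arrowIdeal_sq_sup (hZ : ∀ z ∈ Z, 2 ≤ z.length) {𝔞 : Ideal R}
    (hs : ∀ i, s i ∈ 𝔞) :
    relationSpan Z P s 1 ≤ arrowIdeal R V ^ 2 ⊔ coeffIdeal 𝔞 V ⊓ arrowIdeal R V := by
  refine relationSpan_le (pathSpan_le.mpr fun p hp => Submodule.mem_sup_left
    (ofPath_mem_arrowIdeal_sq (two_le_length_of_not_isZAdmissible hZ hp))) fun i x y p hp => ?_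
  rw [ofPath_mul_relator]
  refine sub_mem (Submodule.mem_sup_right ⟨smul_mem_coeffIdeal (hs i) _,
    Submodule.smul_mem _ _ (ofPath_mem_arrowIdeal hp)⟩) (Submodule.mem_sup_left ?_)
  split_ifs
  · rw [pow_two]
    exact Submodule.mul_mem_mul (ofPath_mem_arrowIdeal hp)
      (sigma_mem fun c hc => ofPath_mem_arrowIdeal hc.nontrivial)
  · exact zero_mem _

theorem smul_e_mem {X : Submodule R (PathAlgebra R V)}
    (hI : idealSubmodule (stringIdeal Z P s) ≤ X) (hA : arrowIdeal R V ≤ X)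
    {r : R} (hr : r ∈ Ideal.span (Set.range s)) (x : V) : r • e R x ∈ X := by
  refine Ideal.span_le (I := X.comap (LinearMap.toSpanSingleton R _ (e R x))).mpr ?_ hr
  rintro _ ⟨i, rfl⟩
  have hrel := hI (mem_idealSubmodule.mpr (relator_mem_stringIdeal (P := P) (s := s) i x))
  refine (Submodule.sub_mem_iff_left X ?_).mp hrel
  split_ifs
  · exact sigma_mem fun c hc => hA (ofPath_mem_arrowIdeal hc.nontrivial)
  · exact zero_mem _

variable [Finite (Total V)]

theorem exists_arrowIdeal_pow_le (hsp : IsSpecialPair Z) (hP : IsPrimitiveNervePartition Z P)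
    {𝔞 : Ideal R} (hs : ∀ i, s i ∈ 𝔞) :
    ∃ m : ℕ, 0 < m ∧
      arrowIdeal R V ^ m ≤ idealSubmodule (stringIdeal Z P s) ⊔ coeffIdeal 𝔞 V := by
  obtain ⟨h, -, hlong⟩ := exists_length_bound hsp
  refine ⟨h + 1, h.succ_pos, (arrowIdeal_pow_le _).trans (pathSpan_le.mpr fun p hp => ?_)⟩
  obtain ⟨x, y, p⟩ := p
  by_cases hadm : IsZAdmissible Z p
  · obtain ⟨c, q, hc, hq, rfl⟩ := hlong x y p hadm hp
    obtain ⟨i, hi⟩ := hP.exists_mem hc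
    rw [← sub_sub_self (s i • ofPath R ⟨x, y, q⟩) (ofPath R _)]
    exact sub_mem (Submodule.mem_sup_right (smul_mem_coeffIdeal (hs i) _))
      (Submodule.mem_sup_left
        (relationSpan_le_stringIdeal 1 (smul_ofPath_sub_mem_relationSpan hsp hq hi hc hadm)))
  · exact Submodule.mem_sup_left
      (nonadmissibleSpan_le_stringIdeal (ofPath_mem_nonadmissibleSpan hadm))

theorem exists_arrowIdeal_le (hsp : IsSpecialPair Z) (hP : IsPrimitiveNervePartition Z P) :
    ∃ h : ℕ, 0 < h ∧ arrowIdeal R V ≤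
      idealSubmodule (stringIdeal Z P s) ⊔ ⨆ l ∈ Set.Icc 1 h, lengthSpan R V l := by
  obtain ⟨h, h0, hlong⟩ := exists_length_bound hsp
  refine ⟨h, h0, arrowIdeal_le ?_⟩
  rw [iSup_lengthSpan]
  rintro ⟨x, y, p⟩ hp
  induction hm : p.length using Nat.strong_induction_on generalizing p with
  | _ m ih =>
  subst hm
  by_cases hadm : IsZAdmissible Z p
  · obtain hph | hph := le_or_gt p.length h
    · exact Submodule.mem_sup_right (ofPath_mem_pathSpan ⟨hp, hph⟩)
    · obtain ⟨c, q, hc, hq, rfl⟩ := hlong x y p hadm hph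
      obtain ⟨i, hi⟩ := hP.exists_mem hc
      have hqc : q.length < (c.comp q).length := by
        rw [length_comp]
        exact Nat.lt_add_of_pos_left hc.nontrivial
      rw [← sub_sub_self (s i • ofPath R ⟨x, y, q⟩) (ofPath R _)]
      exact sub_mem (Submodule.smul_mem _ _ (ih _ hqc q hq rfl)) (Submodule.mem_sup_left
        (relationSpan_le_stringIdeal 1 (smul_ofPath_sub_mem_relationSpan hsp hq hi hc hadm)))
  · exact Submodule.mem_sup_left
      (nonadmissibleSpan_le_stringIdeal (ofPath_mem_nonadmissibleSpan hadm))

theorem exists_coeffIdeal_le (hsp : IsSpecialPair Z) (hP : IsPrimitiveNervePartition Z P) :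
    ∃ h : ℕ, 0 < h ∧ coeffIdeal (Ideal.span (Set.range s)) V ≤
      idealSubmodule (stringIdeal Z P s) ⊔ ⨆ l ∈ Set.Icc 1 h, lengthSpan R V l := by
  obtain ⟨h, h0, hA⟩ := exists_arrowIdeal_le (R := R) (s := s) hsp hP
  refine ⟨h, h0, coeffIdeal_le fun r hr p => ?_⟩
  obtain ⟨x, y, p⟩ := p
  obtain hp | hp := p.length.eq_zero_or_pos
  · obtain rfl := eq_of_length_zero p hp
    obtain rfl := Path.eq_nil_of_length_zero p hp
    exact smul_e_mem le_sup_left hA hr x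
  · exact Submodule.smul_mem _ r (hA (ofPath_mem_arrowIdeal hp))

theorem isAdmissibleIdeal_stringIdeal [IsLocalRing R] [IsNoetherianRing R]
    (hZ : ∀ z ∈ Z, 2 ≤ z.length) (hsp : IsSpecialPair Z) (hP : IsPrimitiveNervePartition Z P)
    (hreg : RingTheory.Sequence.IsRegular R (List.ofFn s))
    (hgen : Ideal.span (Set.range s) = maximalIdeal R) :
    IsAdmissibleIdeal (stringIdeal Z P s) := by
  have hs : ∀ i, s i ∈ maximalIdeal R := fun i => hgen ▸ Ideal.subset_span (Set.mem_range_self i)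
  refine ⟨?_, ?_, exists_arrowIdeal_pow_le hsp hP hs, hgen ▸ exists_coeffIdeal_le hsp hP⟩
  · rw [idealSubmodule_stringIdeal hsp hP]
    refine relationSpan_zero_le.trans (sup_le ((relationSpan_one_le_arrowIdeal hZ).trans
      le_sup_left) (Submodule.span_le.mpr ?_))
    rintro _ ⟨⟨i, x⟩, rfl⟩
    exact relator_mem_arrowIdeal_sup_coeffIdeal _ (hs i) x
  · rw [idealSubmodule_stringIdeal_inf_arrowIdeal hZ hsp hP hreg]
    exact relationSpan_one_le_arrowIdeal_sq_sup hZ hs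

end StringAlgebra

/-! ### Arrow-directness -/

section ArrowDirect

open Quiver Quiver.Path PathAlgebra

variable {R : Type w} [CommRing R] {V : Type u} [Quiver.{v} V]

/-- The paths whose first arrow belongs to a given set of arrows with tail `x`. -/
def startingWith {x : V} (B : Set (Σ z : V, x ⟶ z)) : Set (QPath V) :=
  {p | ∃ b ∈ B, (arrowList p.path).head? = some ⟨x, b.1, b.2⟩}

/-- The paths whose last arrow belongs to a given set of arrows with head `y`. -/
def endingWith {y : V} (B : Set (Σ z : V, z ⟶ y)) : Set (QPath V) :=
  {p | ∃ b ∈ B, (arrowList p.path).getLast? = some ⟨b.1, y, b.2⟩}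

theorem length_pos_of_mem_startingWith {x : V} {B : Set (Σ z : V, x ⟶ z)} {p : QPath V}
    (h : p ∈ startingWith B) : 0 < p.length := by
  obtain ⟨b, -, hb⟩ := h
  exact (List.length_pos_of_mem (List.mem_of_head? hb)).trans_eq (length_arrowList _)

theorem length_pos_of_mem_endingWith {y : V} {B : Set (Σ z : V, z ⟶ y)} {p : QPath V}
    (h : p ∈ endingWith B) : 0 < p.length := by
  obtain ⟨b, -, hb⟩ := h
  exact (List.length_pos_of_mem (List.mem_of_getLast? hb)).trans_eq (length_arrowList _)

theorem disjoint_startingWith {x : V} {B C : Set (Σ z : V, x ⟶ z)} (h : Disjoint B C) :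
    Disjoint (startingWith B) (startingWith C) := by
  refine Set.disjoint_left.mpr fun p ⟨⟨_, b⟩, hb, hpb⟩ ⟨⟨_, c⟩, hc, hpc⟩ =>
    Set.disjoint_left.mp h hb ?_
  cases Option.some.inj (hpb.symm.trans hpc)
  exact hc

theorem disjoint_endingWith {y : V} {B C : Set (Σ z : V, z ⟶ y)} (h : Disjoint B C) :
    Disjoint (endingWith B) (endingWith C) := by
  refine Set.disjoint_left.mpr fun p ⟨⟨_, b⟩, hb, hpb⟩ ⟨⟨_, c⟩, hc, hpc⟩ =>
    Set.disjoint_left.mp h hb ?_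
  cases Option.some.inj (hpb.symm.trans hpc)
  exact hc

section

variable [Fintype V]

theorem mul_arrow_mem_pathSpan {x : V} {B : Set (Σ z : V, x ⟶ z)} {b : Σ z : V, x ⟶ z}
    (hb : b ∈ B) (w : PathAlgebra R V) : w * arrow R b.2 ∈ pathSpan R (startingWith B) :=
  pathSpan_mul_pathSpan_le
    (S := Set.univ) (T := {QPath.ofArrow b.2}) (U := startingWith B)
    (fun _ _ _ q p _ hp => ⟨b, hb, by cases hp; exact head?_arrowList_comp q Nat.one_pos⟩)
    (Submodule.mul_mem_mul (mem_pathSpan_univ w) (ofPath_mem_pathSpan rfl))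

theorem arrow_mul_mem_pathSpan {y : V} {B : Set (Σ z : V, z ⟶ y)} {b : Σ z : V, z ⟶ y}
    (hb : b ∈ B) (w : PathAlgebra R V) : arrow R b.2 * w ∈ pathSpan R (endingWith B) :=
  pathSpan_mul_pathSpan_le
    (S := {QPath.ofArrow b.2}) (T := Set.univ) (U := endingWith B)
    (fun _ _ _ q p hq _ => ⟨b, hb, by cases hq; exact getLast?_arrowList_comp p Nat.one_pos⟩)
    (Submodule.mul_mem_mul (ofPath_mem_pathSpan rfl) (mem_pathSpan_univ w))

theorem mk'_eq_zero_iff {I : TwoSidedIdeal (PathAlgebra R V)} {u : PathAlgebra R V} :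
    I.ringCon.mk' u = 0 ↔ u ∈ I := by
  rw [← TwoSidedIdeal.mem_ker, TwoSidedIdeal.ker_ringCon_mk']

theorem exists_mem_pathSpan_startingWith {I : TwoSidedIdeal (PathAlgebra R V)} {x : V}
    {B : Set (Σ z : V, x ⟶ z)} {t : I.ringCon.Quotient}
    (ht : t ∈ ⨆ b ∈ B, Submodule.span I.ringCon.Quotient {quotArrow I b.2}) :
    ∃ u ∈ pathSpan R (startingWith B), I.ringCon.mk' u = t := by
  rw [iSup_subtype'] at ht
  induction ht using Submodule.iSup_induction' with
  | mem b t ht =>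
    obtain ⟨w, rfl⟩ := Submodule.mem_span_singleton.mp ht
    obtain ⟨w, rfl⟩ := I.ringCon.mk'_surjective w
    exact ⟨w * arrow R b.1.2, mul_arrow_mem_pathSpan b.2 w, map_mul _ _ _⟩
  | zero => exact ⟨0, zero_mem _, map_zero _⟩
  | add t t' _ _ ht ht' =>
    obtain ⟨⟨u, hu, rfl⟩, ⟨u', hu', rfl⟩⟩ := And.intro ht ht'
    exact ⟨u + u', add_mem hu hu', map_add _ _ _⟩

theorem exists_mem_pathSpan_endingWith {I : TwoSidedIdeal (PathAlgebra R V)} {y : V}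
    {B : Set (Σ z : V, z ⟶ y)} {t : I.ringCon.Quotient}
    (ht : t ∈ ⨆ b ∈ B, Submodule.span I.ringCon.Quotientᵐᵒᵖ {quotArrow I b.2}) :
    ∃ u ∈ pathSpan R (endingWith B), I.ringCon.mk' u = t := by
  rw [iSup_subtype'] at ht
  induction ht using Submodule.iSup_induction' with
  | mem b t ht =>
    obtain ⟨⟨w⟩, rfl⟩ := Submodule.mem_span_singleton.mp ht
    obtain ⟨w, rfl⟩ := I.ringCon.mk'_surjective w
    exact ⟨arrow R b.1.2 * w, arrow_mul_mem_pathSpan b.2 w, map_mul _ _ _⟩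
  | zero => exact ⟨0, zero_mem _, map_zero _⟩
  | add t t' _ _ ht ht' =>
    obtain ⟨⟨u, hu, rfl⟩, ⟨u', hu', rfl⟩⟩ := And.intro ht ht'
    exact ⟨u + u', add_mem hu hu', map_add _ _ _⟩

end

variable {Z : Set (QPath V)}

/-- Invariance of a set `S` of paths under the insertion of primitive cycles at the tail: whether a
nontrivial path `p` lies in `S` does not change when it is precomposed with a primitive cycle,
provided that the composition is admissible. Projecting onto the span of such an `S` preserves the
relations `p * (s i • e_x - σ_x)` modulo nonadmissible paths. -/
def IsCycleInvariant (Z : Set (QPath V)) (S : Set (QPath V)) : Prop :=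
  ∀ ⦃x y : V⦄ (c : Path x x) (p : Path x y), IsPrimitiveCycle Z c → 0 < p.length →
    IsZAdmissible Z (c.comp p) → ((⟨x, y, c.comp p⟩ : QPath V) ∈ S ↔ (⟨x, y, p⟩ : QPath V) ∈ S)

theorem isCycleInvariant_startingWith (hsp : IsSpecialPair Z) {x : V} (B : Set (Σ z : V, x ⟶ z)) :
    IsCycleInvariant Z (startingWith B) := by
  intro x y c p hc hp h
  simp only [startingWith, Set.mem_ofPred_eq, head?_arrowList_comp p hc.nontrivial,
    hc.head?_eq hsp hp h]

theorem isCycleInvariant_endingWith {y : V} (B : Set (Σ z : V, z ⟶ y)) :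
    IsCycleInvariant Z (endingWith B) := by
  intro x y c p _ hp _
  simp only [endingWith, Set.mem_ofPred_eq, getLast?_arrowList_comp c hp]

theorem proj_mem_nonadmissibleSpan {S : Set (QPath V)} {u : PathAlgebra R V}
    (hu : u ∈ nonadmissibleSpan R Z) : proj R S u ∈ nonadmissibleSpan R Z := by
  refine (pathSpan_le (X := (nonadmissibleSpan R Z).comap (proj R S))).mpr (fun p hp => ?_) hu
  rw [Submodule.mem_comap]
  by_cases h : p ∈ S
  · rw [proj_ofPath_of_mem h]
    exact ofPath_mem_pathSpan hp
  · rw [proj_ofPath_of_notMem h]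
    exact zero_mem _

variable [Fintype V]

theorem proj_ofPath_mul_sigma_sub_mem {S : Set (QPath V)} (hS : IsCycleInvariant Z S) {x y : V}
    {p : Path x y} (hp : 0 < p.length) (h : (⟨x, y, p⟩ : QPath V) ∈ S) :
    proj R S (ofPath R ⟨x, y, p⟩ * sigma R Z x) - ofPath R ⟨x, y, p⟩ * sigma R Z x ∈
      nonadmissibleSpan R Z := by
  refine sigma_mem (X := (nonadmissibleSpan R Z).comap
    ((proj R S - LinearMap.id) ∘ₗ LinearMap.mulLeft R (ofPath R ⟨x, y, p⟩))) fun c hc => ?_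
  change proj R S (_ * _) - _ * _ ∈ nonadmissibleSpan R Z
  rw [ofPath_mul_ofPath]
  by_cases hcp : IsZAdmissible Z (c.comp p)
  · rw [proj_ofPath_of_mem ((hS c p hc hp hcp).mpr h), sub_self]
    exact zero_mem _
  · have hmem := ofPath_mem_nonadmissibleSpan (R := R) hcp
    exact sub_mem (proj_mem_nonadmissibleSpan hmem) hmem

theorem proj_ofPath_mul_sigma_mem {S : Set (QPath V)} (hS : IsCycleInvariant Z S) {x y : V}
    {p : Path x y} (hp : 0 < p.length) (h : (⟨x, y, p⟩ : QPath V) ∉ S) :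
    proj R S (ofPath R ⟨x, y, p⟩ * sigma R Z x) ∈ nonadmissibleSpan R Z := by
  refine sigma_mem (X := (nonadmissibleSpan R Z).comap
    (proj R S ∘ₗ LinearMap.mulLeft R (ofPath R ⟨x, y, p⟩))) fun c hc => ?_
  change proj R S (_ * _) ∈ nonadmissibleSpan R Z
  rw [ofPath_mul_ofPath]
  by_cases hcp : IsZAdmissible Z (c.comp p)
  · rw [proj_ofPath_of_notMem (mt (hS c p hc hp hcp).mp h)]
    exact zero_mem _
  · exact proj_mem_nonadmissibleSpan (ofPath_mem_nonadmissibleSpan hcp)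

variable {n : ℕ} {P : Fin n → Set V} {s : Fin n → R}

theorem proj_mem_relationSpan {S : Set (QPath V)} (hS : IsCycleInvariant Z S)
    {u : PathAlgebra R V} (hu : u ∈ relationSpan Z P s 1) :
    proj R S u ∈ relationSpan Z P s 1 := by
  refine relationSpan_le (X := (relationSpan Z P s 1).comap (proj R S))
    (fun u hu => nonadmissibleSpan_le_relationSpan 1 (proj_mem_nonadmissibleSpan hu))
    (fun i x y p hp => ?_) hu
  have hrel := ofPath_mul_relator_mem_relationSpan (Z := Z) (P := P) (s := s) i hp
  rw [Submodule.mem_comap]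
  by_cases h : (⟨x, y, p⟩ : QPath V) ∈ S
  · rw [← (relationSpan Z P s 1).sub_mem_iff_left hrel, ofPath_mul_relator, map_sub, map_smul,
      proj_ofPath_of_mem h, sub_sub_sub_cancel_left]
    refine nonadmissibleSpan_le_relationSpan 1 ?_
    split_ifs
    · exact sub_mem_comm_iff.mp (proj_ofPath_mul_sigma_sub_mem hS hp h)
    · simp only [map_zero, sub_self, zero_mem]
  · rw [ofPath_mul_relator, map_sub, map_smul, proj_ofPath_of_notMem h, smul_zero, zero_sub]
    refine nonadmissibleSpan_le_relationSpan 1 (neg_mem ?_)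
    split_ifs
    · exact proj_ofPath_mul_sigma_mem hS hp h
    · exact map_zero (proj R S) ▸ zero_mem _

variable [Finite (Total V)]

theorem mk'_eq_zero_of_mk'_eq [IsLocalRing R] [IsNoetherianRing R]
    (hZ : ∀ z ∈ Z, 2 ≤ z.length) (hsp : IsSpecialPair Z) (hP : IsPrimitiveNervePartition Z P)
    (hreg : RingTheory.Sequence.IsRegular R (List.ofFn s)) {S T : Set (QPath V)}
    (hS : IsCycleInvariant Z S) (hST : Disjoint S T) (hS₀ : ∀ p ∈ S, 0 < p.length)
    (hT₀ : ∀ p ∈ T, 0 < p.length) {u u' : PathAlgebra R V} (hu : u ∈ pathSpan R S)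
    (hu' : u' ∈ pathSpan R T)
    (h : (stringIdeal Z P s).ringCon.mk' u = (stringIdeal Z P s).ringCon.mk' u') :
    (stringIdeal Z P s).ringCon.mk' u = 0 := by
  have hI : u - u' ∈ idealSubmodule (stringIdeal Z P s) := by
    rw [mem_idealSubmodule, ← mk'_eq_zero_iff, map_sub, h, sub_self]
  have hA : u - u' ∈ arrowIdeal R V :=
    sub_mem (pathSpan_le.mpr (fun p hp => ofPath_mem_arrowIdeal (hS₀ p hp)) hu)
      (pathSpan_le.mpr (fun p hp => ofPath_mem_arrowIdeal (hT₀ p hp)) hu')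
  have hproj := proj_mem_relationSpan hS
    ((idealSubmodule_stringIdeal_inf_arrowIdeal hZ hsp hP hreg).le ⟨hI, hA⟩)
  rw [map_sub, proj_eq_self hu, proj_eq_zero (pathSpan_mono hST.subset_compl_left hu'),
    sub_zero] at hproj
  exact mk'_eq_zero_iff.mpr (mem_idealSubmodule.mp (relationSpan_le_stringIdeal 1 hproj))

section

variable [IsLocalRing R] [IsNoetherianRing R] (hZ : ∀ z ∈ Z, 2 ≤ z.length)
  (hsp : IsSpecialPair Z) (hP : IsPrimitiveNervePartition Z P)
  (hreg : RingTheory.Sequence.IsRegular R (List.ofFn s))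
include hZ hsp hP hreg

theorem disjoint_iSup_span_left {x : V} {B C : Set (Σ z : V, x ⟶ z)} (h : Disjoint B C) :
    Disjoint
      (⨆ b ∈ B, Submodule.span (stringIdeal Z P s).ringCon.Quotient
        {quotArrow (stringIdeal Z P s) b.2})
      (⨆ b ∈ C, Submodule.span (stringIdeal Z P s).ringCon.Quotient
        {quotArrow (stringIdeal Z P s) b.2}) := by
  refine Submodule.disjoint_def.mpr fun t ht ht' => ?_
  obtain ⟨u, hu, rfl⟩ := exists_mem_pathSpan_startingWith ht
  obtain ⟨u', hu', heq⟩ := exists_mem_pathSpan_startingWith ht'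
  exact mk'_eq_zero_of_mk'_eq hZ hsp hP hreg (isCycleInvariant_startingWith hsp B)
    (disjoint_startingWith h) (fun _ => length_pos_of_mem_startingWith)
    (fun _ => length_pos_of_mem_startingWith) hu hu' heq.symm

theorem disjoint_iSup_span_right {y : V} {B C : Set (Σ z : V, z ⟶ y)} (h : Disjoint B C) :
    Disjoint
      (⨆ b ∈ B, Submodule.span (stringIdeal Z P s).ringCon.Quotientᵐᵒᵖ
        {quotArrow (stringIdeal Z P s) b.2})
      (⨆ b ∈ C, Submodule.span (stringIdeal Z P s).ringCon.Quotientᵐᵒᵖ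
        {quotArrow (stringIdeal Z P s) b.2}) := by
  refine Submodule.disjoint_def.mpr fun t ht ht' => ?_
  obtain ⟨u, hu, rfl⟩ := exists_mem_pathSpan_endingWith ht
  obtain ⟨u', hu', heq⟩ := exists_mem_pathSpan_endingWith ht'
  exact mk'_eq_zero_of_mk'_eq hZ hsp hP hreg (isCycleInvariant_endingWith B)
    (disjoint_endingWith h) (fun _ => length_pos_of_mem_endingWith)
    (fun _ => length_pos_of_mem_endingWith) hu hu' heq.symm

theorem isArrowDirect_stringIdeal : IsArrowDirect (stringIdeal Z P s) := by
  intro x y a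
  constructor
  · have h := disjoint_iSup_span_left hZ hsp hP hreg
      (disjoint_compl_right (a := {(⟨y, a⟩ : Σ z : V, x ⟶ z)}))
    rw [iSup_singleton] at h
    exact h.eq_bot
  · have h := disjoint_iSup_span_right hZ hsp hP hreg
      (disjoint_compl_right (a := {(⟨x, a⟩ : Σ z : V, z ⟶ y)}))
    rw [iSup_singleton] at h
    exact h.eq_bot

end

end ArrowDirect

theorem theorem1p1 {V : Type u} [Quiver.{v} V] [Fintype V] [∀ x y : V, Finite (x ⟶ y)]
    (Z : Set (QPath V)) (hZ : ∀ z ∈ Z, 2 ≤ z.length) (hsp : IsSpecialPair Z)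
    {n : ℕ} (P : Fin n → Set V) (hP : IsPrimitiveNervePartition Z P)
    {R : Type w} [CommRing R] [IsRegularLocalRing R] (hdim : ringKrullDim R = n)
    (s : Fin n → R) (hreg : RingTheory.Sequence.IsRegular R (List.ofFn s))
    (hgen : Ideal.span (Set.range s) = IsLocalRing.maximalIdeal R) :
    (∀ x : V, {c : Quiver.Path x x | IsPrimitiveCycle Z c}.Finite) ∧
    (∀ p : QPath V, IsZAdmissible Z p.path →
      PathAlgebra.ofPath R p ∉ stringIdeal Z P s) ∧
    (IsBiserial V → IsStringAlgebra (stringIdeal Z P s)) := by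
  refine ⟨finite_setOf_isPrimitiveCycle hsp,
    fun _ hp => ofPath_notMem_stringIdeal hZ hsp hP hreg hp, fun hbi => ⟨hbi, ?_, ?_, ?_⟩⟩
  · exact isAdmissibleIdeal_stringIdeal hZ hsp hP hreg hgen
  · exact isSpecialIdeal_stringIdeal hsp
  · exact isArrowDirect_stringIdeal hZ hsp hP hreg
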